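/- Write $(X:Y:Z)$ for the homogeneous coordinates of $\mathbb{P}^2(\mathbb{C})$ and $x=X/Z$, $y=Y/Z$. A foliation of degree $2$ on $\mathbb{P}^2(\mathbb{C})$ is given, uniquely up to a nonzero constant factor, by a $1$-form $\omega=a\,dX+b\,dY+c\,dZ$ with $a,b,c$ homogeneous polynomials of degree $3$ without common factor such that $aX+bY+cZ=0$. The set $\mathscr{F}(2;2)$ of these foliations is thus a Zariski open subset of the projective space $\mathbb{P}^{14}(\mathbb{C})$ of all such $1$-forms (without the condition on common factors), and it carries the ordinary topology and the complex structure of $\mathbb{P}^{14}(\mathbb{C})$. The group $\mathrm{Aut}(\mathbb{P}^2(\mathbb{C}))=\mathrm{PGL}_3(\mathbb{C})$ acts on $\mathscr{F}(2;2)$; two foliations are conjugate if they lie in the same orbit, and $\mathcal{O}(\mathcal{F})$ denotes the orbit of $\mathcal{F}$. A foliation $\mathcal{F}\in\mathscr{F}(2;2)$ is given by a pencil of conics $Q_1+\lambda Q_2$ if $Q_1,Q_2$ are linearly independent quadratic forms in $X,Y,Z$ such that $Q_1/Q_2$ is a first integral of $\mathcal{F}$. Let - $\mathcal{F}_5$ be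 the foliation given in the chart $Z=1$ by $x^2\,dy+y^2(x\,dy-y\,dx)$ (the pencil $(Y^2-XZ)+\lambda XY$), - $\mathcal{F}_6$ be the foliation given by the pencil $X(Y+Z)+\lambda\,Y(X+Z)$, - $\mathcal{F}_7$ be the foliation given by the pencil $XZ+\lambda\,Y(Y-X)$. **Proposition.** Let $\mathcal{F}\in\mathscr{F}(2;2)$ be given by a pencil of conics. Then $\mathcal{F}$ is conjugate to $\mathcal{F}_5$, $\mathcal{F}_6$ or $\mathcal{F}_7$. Moreover, each of the orbits below is a complex submanifold of $\mathscr{F}(2;2)$ and, the closures being taken in $\mathscr{F}(2;2)$ for the ordinary topology, 1. $\overline{\mathcal{O}(\mathcal{F}_5)}=\mathcal{O}(\mathcal{F}_5)$ and $\dim\mathcal{O}(\mathcal{F}_5)=6$; 2. $\overline{\mathcal{O}(\mathcal{F}_7)}=\mathcal{O}(\mathcal{F}_5)\cup\mathcal{O}(\mathcal{F}_7)$ and $\dim\mathcal{O}(\mathcal{F}_7)=7$; 3. $\overline{\mathcal{O}(\mathcal{F}_6)}=\mathcal{O}(\mathcal{F}_5)\cup\mathcal{O}(\mathcal{F}_6)\cup\mathcal{O}(\mathcal{F}_7)$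 and $\dim\mathcal{O}(\mathcal{F}_6)=8$. -/

import Mathlib

/-!
Foliations of degree `N` on the complex projective plane, the action of `PGL(3, ℂ)` on them, the
ordinary topology and complex submanifolds of the space of foliations, and pencils of conics.
-/

namespace PlaneFoliation

open scoped LinearAlgebra.Projectivization

/-- Polynomials in the homogeneous coordinates `X = X 0`, `Y = X 1`, `Z = X 2`. -/
abbrev Poly : Type := MvPolynomial (Fin 3) ℂ

/-! ### Homogeneous `1`-forms -/

/-- The space of `1`-forms `ω = a dX + b dY + c dZ` on `ℂ³`, written as the triple `(a, b, c)`, with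
`a`, `b`, `c` homogeneous of degree `N + 1` and `a X + b Y + c Z = 0`. -/
def FormSpace (N : ℕ) : Submodule ℂ (Fin 3 → Poly) where
  carrier := {a | (∀ i, (a i).IsHomogeneous (N + 1)) ∧ ∑ i, a i * MvPolynomial.X i = 0}
  add_mem' := by
    rintro a b ⟨ha, ha'⟩ ⟨hb, hb'⟩
    refine ⟨fun i => (ha i).add (hb i), ?_⟩
    simp only [Pi.add_apply, add_mul, Finset.sum_add_distrib, ha', hb', add_zero]
  zero_mem' := ⟨fun i => MvPolynomial.isHomogeneous_zero _ _ _, by simp⟩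
  smul_mem' := by
    rintro c a ⟨ha, ha'⟩
    refine ⟨fun i => ?_, ?_⟩
    · have := (MvPolynomial.isHomogeneous_C (Fin 3) c).mul (ha i)
      simpa [MvPolynomial.smul_eq_C_mul] using this
    · simp only [Pi.smul_apply, smul_mul_assoc, ← Finset.smul_sum, ha', smul_zero]

/-- The components of a `1`-form have no common factor. -/
def NoCommonFactor (a : Fin 3 → Poly) : Prop :=
  ∀ d : Poly, (∀ i, d ∣ a i) → IsUnit d

/-- The exponents of the monomials of degree `N + 1` in three variables. -/
abbrev Exponent (N : ℕ) : Type :=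
  {d : Fin 3 →₀ ℕ // d ∈ (Finset.univ : Finset (Fin 3)).finsuppAntidiag (N + 1)}

/-- The coefficients of a `1`-form. -/
noncomputable def coeffs (N : ℕ) : FormSpace N →ₗ[ℂ] (Fin 3 × Exponent N → ℂ) where
  toFun ω := fun p => MvPolynomial.coeff p.2.1 (ω.1 p.1)
  map_add' ω η := by
    funext p
    simp
  map_smul' c ω := by
    funext p
    simp

theorem coeffs_injective (N : ℕ) : Function.Injective (coeffs N) := by
  rw [injective_iff_map_eq_zero]
  intro ω h
  apply Subtype.ext
  funext i
  ext d
  by_cases hd : d.degree = N + 1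
  · have hmem : d ∈ (Finset.univ : Finset (Fin 3)).finsuppAntidiag (N + 1) := by
      rw [Finset.mem_finsuppAntidiag]
      refine ⟨?_, Finset.subset_univ _⟩
      rw [← hd, Finsupp.degree_eq_sum]
    exact congrFun h (i, ⟨d, hmem⟩)
  · simpa using (ω.2.1 i).coeff_eq_zero hd

/-- The norm of a `1`-form is the maximum of the absolute values of its coefficients. It induces the
usual topology of the finite-dimensional space `FormSpace N`. -/
noncomputable instance (N : ℕ) : NormedAddCommGroup (FormSpace N) :=
  NormedAddCommGroup.induced (FormSpace N) (Fin 3 × Exponent N → ℂ) (coeffs N) (coeffs_injective N)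

noncomputable instance (N : ℕ) : NormedSpace ℂ (FormSpace N) :=
  NormedSpace.induced ℂ (FormSpace N) (Fin 3 × Exponent N → ℂ) (coeffs N)

instance (N : ℕ) : FiniteDimensional ℂ (FormSpace N) :=
  FiniteDimensional.of_injective (coeffs N) (coeffs_injective N)

/-! ### Pull-back by linear maps -/

/-- The substitution `P ↦ P ∘ φ`, where `φ` acts linearly on `ℂ³`. -/
noncomputable def subst (φ : Matrix (Fin 3) (Fin 3) ℂ) : Poly →ₐ[ℂ] Poly :=
  MvPolynomial.aeval fun i => ∑ j, MvPolynomial.C (φ i j) * MvPolynomial.X j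

theorem subst_X (φ : Matrix (Fin 3) (Fin 3) ℂ) (i : Fin 3) :
    subst φ (MvPolynomial.X i) = ∑ j, MvPolynomial.C (φ i j) * MvPolynomial.X j := by
  simp [subst]

theorem subst_C (φ : Matrix (Fin 3) (Fin 3) ℂ) (c : ℂ) :
    subst φ (MvPolynomial.C c) = MvPolynomial.C c := by
  simp [subst]

theorem subst_one (P : Poly) : subst 1 P = P := by
  have h : subst 1 = AlgHom.id ℂ Poly := by
    apply MvPolynomial.algHom_ext
    intro i
    rw [subst_X]
    simp [Matrix.one_apply]
  rw [h, AlgHom.id_apply]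

theorem subst_mul (φ ψ : Matrix (Fin 3) (Fin 3) ℂ) (P : Poly) :
    subst (φ * ψ) P = subst ψ (subst φ P) := by
  have h : subst (φ * ψ) = (subst ψ).comp (subst φ) := by
    apply MvPolynomial.algHom_ext
    intro i
    rw [AlgHom.comp_apply, subst_X, subst_X]
    simp only [map_sum, map_mul, subst_C, subst_X, Matrix.mul_apply, Finset.sum_mul,
      Finset.mul_sum]
    rw [Finset.sum_comm]
    simp only [mul_assoc]
  rw [h, AlgHom.comp_apply]

theorem subst_isHomogeneous (φ : Matrix (Fin 3) (Fin 3) ℂ) {P : Poly} {n : ℕ}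
    (hP : P.IsHomogeneous n) : (subst φ P).IsHomogeneous n := by
  have h := hP.aeval (R := ℂ) (fun i => ∑ j, MvPolynomial.C (φ i j) * MvPolynomial.X j)
    (n := 1) (fun i => MvPolynomial.IsHomogeneous.sum _ _ _ fun j _ =>
      (MvPolynomial.isHomogeneous_X ℂ j).C_mul _)
  simpa [subst] using h

/-- The components of the pull-back `φ^* ω`, where `ω = ∑ i, a i dX_i`:
since `φ^* dX_i = ∑ j, φ i j dX_j`, the coefficient of `dX_j` is `∑ i, φ i j (a i ∘ φ)`. -/
noncomputable def pullbackFun (φ : Matrix (Fin 3) (Fin 3) ℂ) (a : Fin 3 → Poly) : Fin 3 → Poly :=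
  fun j => ∑ i, MvPolynomial.C (φ i j) * subst φ (a i)

theorem pullbackFun_one (a : Fin 3 → Poly) : pullbackFun 1 a = a := by
  funext j
  simp [pullbackFun, subst_one, Matrix.one_apply]

theorem pullbackFun_mul (φ ψ : Matrix (Fin 3) (Fin 3) ℂ) (a : Fin 3 → Poly) :
    pullbackFun (φ * ψ) a = pullbackFun ψ (pullbackFun φ a) := by
  funext j
  simp only [pullbackFun, map_sum, map_mul, subst_C, subst_mul, Matrix.mul_apply, Finset.sum_mul,
    Finset.mul_sum]
  rw [Finset.sum_comm]
  refine Finset.sum_congr rfl fun k _ => Finset.sum_congr rfl fun i _ => ?_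
  ring

theorem pullbackFun_mem {N : ℕ} (φ : Matrix (Fin 3) (Fin 3) ℂ) {a : Fin 3 → Poly}
    (ha : a ∈ FormSpace N) : pullbackFun φ a ∈ FormSpace N := by
  refine ⟨fun j => MvPolynomial.IsHomogeneous.sum _ _ _ fun i _ =>
    (subst_isHomogeneous φ (ha.1 i)).C_mul _, ?_⟩
  have h := congrArg (subst φ) ha.2
  rw [map_zero, map_sum] at h
  rw [← h]
  simp only [map_mul, subst_X, pullbackFun, Finset.sum_mul, Finset.mul_sum]
  rw [Finset.sum_comm]
  refine Finset.sum_congr rfl fun k _ => Finset.sum_congr rfl fun i _ => ?_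
  ring

/-- The pull-back `φ^*` on the space of `1`-forms. -/
noncomputable def pullback {N : ℕ} (φ : Matrix (Fin 3) (Fin 3) ℂ) :
    FormSpace N →ₗ[ℂ] FormSpace N where
  toFun ω := ⟨pullbackFun φ ω.1, pullbackFun_mem φ ω.2⟩
  map_add' ω η := by
    apply Subtype.ext
    funext j
    simp [pullbackFun, mul_add, Finset.sum_add_distrib]
  map_smul' c ω := by
    apply Subtype.ext
    funext j
    simp [pullbackFun, Finset.smul_sum]

/-- `GL(3, ℂ)` acts on `1`-forms by `g • ω = (g⁻¹)^* ω`. -/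
noncomputable instance (N : ℕ) : DistribMulAction (GL (Fin 3) ℂ) (FormSpace N) where
  smul g ω := pullback (g⁻¹ : GL (Fin 3) ℂ).1 ω
  one_smul ω := by
    apply Subtype.ext
    change pullbackFun ((1 : GL (Fin 3) ℂ)⁻¹).1 ω.1 = ω.1
    rw [inv_one]
    exact pullbackFun_one _
  mul_smul g h ω := by
    apply Subtype.ext
    change pullbackFun ((g * h)⁻¹ : GL (Fin 3) ℂ).1 ω.1 =
      pullbackFun (g⁻¹ : GL (Fin 3) ℂ).1 (pullbackFun (h⁻¹ : GL (Fin 3) ℂ).1 ω.1)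
    rw [← pullbackFun_mul, mul_inv_rev, Units.val_mul]
  smul_zero g := map_zero (pullback (g⁻¹ : GL (Fin 3) ℂ).1)
  smul_add g ω η := map_add (pullback (g⁻¹ : GL (Fin 3) ℂ).1) ω η

theorem smul_val {N : ℕ} (g : GL (Fin 3) ℂ) (ω : FormSpace N) :
    (g • ω).1 = pullbackFun (g⁻¹ : GL (Fin 3) ℂ).1 ω.1 := rfl

instance (N : ℕ) : SMulCommClass (GL (Fin 3) ℂ) ℂ (FormSpace N) :=
  ⟨fun g c ω => map_smul (pullback (g⁻¹ : GL (Fin 3) ℂ).1) c ω⟩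

/-- A scalar matrix multiplies a homogeneous `1`-form by a nonzero constant. -/
theorem scalar_smul {N : ℕ} (u : ℂˣ) (ω : FormSpace N) :
    Matrix.GeneralLinearGroup.scalar (Fin 3) u • ω = (u⁻¹ ^ (N + 2) : ℂˣ) • ω := by
  have hs : ((Matrix.GeneralLinearGroup.scalar (Fin 3) u)⁻¹ : GL (Fin 3) ℂ).1 =
      Matrix.diagonal fun _ => ((u⁻¹ : ℂˣ) : ℂ) := by
    rw [← map_inv]
    rfl
  apply Subtype.ext
  rw [smul_val, hs]
  funext j
  have hsub : subst (Matrix.diagonal fun _ => ((u⁻¹ : ℂˣ) : ℂ)) (ω.1 j) =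
      MvPolynomial.C (((u⁻¹ : ℂˣ) : ℂ) ^ (N + 1)) * ω.1 j := by
    have h1 : ∀ i : Fin 3, (∑ k, MvPolynomial.C
        ((Matrix.diagonal fun _ : Fin 3 => ((u⁻¹ : ℂˣ) : ℂ)) i k) * MvPolynomial.X k : Poly) =
        MvPolynomial.C ((u⁻¹ : ℂˣ) : ℂ) * MvPolynomial.X i := by
      intro i
      rw [Finset.sum_eq_single i]
      · simp
      · intro k _ hk
        simp [Matrix.diagonal_apply_ne' _ hk]
      · simp
    have h2 := ω.2.1 j
    rw [subst]
    simp only [h1]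
    conv_rhs => rw [(ω.1 j).as_sum, Finset.mul_sum]
    conv_lhs => rw [(ω.1 j).as_sum, map_sum]
    refine Finset.sum_congr rfl fun d hd => ?_
    have hdeg : ∑ i, d i = N + 1 := by
      have := h2 (MvPolynomial.mem_support_iff.mp hd)
      rw [← this, ← Finsupp.degree_eq_sum, Finsupp.degree_eq_weight_one]
      rfl
    rw [MvPolynomial.aeval_monomial, MvPolynomial.monomial_eq,
      Finsupp.prod_fintype _ _ (by simp), Finsupp.prod_fintype _ _ (by simp)]
    simp only [mul_pow, Finset.prod_mul_distrib]
    rw [Finset.prod_pow_eq_pow_sum, hdeg, MvPolynomial.algebraMap_eq, ← map_pow]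
    ring
  rw [pullbackFun, Finset.sum_eq_single j]
  · rw [hsub]
    simp only [Matrix.diagonal_apply_eq]
    rw [← mul_assoc, ← map_mul, ← pow_succ']
    rw [← MvPolynomial.smul_eq_C_mul]
    simp [Units.smul_def]
  · intro k _ hk
    simp [Matrix.diagonal_apply_ne _ hk]
  · simp

theorem NoCommonFactor.pullbackFun {a : Fin 3 → Poly} (ha : NoCommonFactor a)
    (g : GL (Fin 3) ℂ) : NoCommonFactor (PlaneFoliation.pullbackFun g.1 a) := by
  intro d hd
  have hinv : PlaneFoliation.pullbackFun (g⁻¹ : GL (Fin 3) ℂ).1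
      (PlaneFoliation.pullbackFun g.1 a) = a := by
    rw [← pullbackFun_mul, ← Units.val_mul, mul_inv_cancel]
    exact pullbackFun_one a
  have h1 : IsUnit (subst (g⁻¹ : GL (Fin 3) ℂ).1 d) := by
    apply ha
    intro i
    rw [← hinv]
    exact Finset.dvd_sum fun k _ => Dvd.dvd.mul_left (map_dvd _ (hd k)) _
  have h2 := h1.map (subst g.1)
  rwa [← subst_mul, ← Units.val_mul, inv_mul_cancel, Units.val_one, subst_one] at h2

theorem NoCommonFactor.smul {a : Fin 3 → Poly} (ha : NoCommonFactor a) (u : ℂˣ) :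
    NoCommonFactor (u • a) := by
  intro d hd
  apply ha
  intro i
  have h := (hd i).mul_left (MvPolynomial.C ((u⁻¹ : ℂˣ) : ℂ))
  have h2 : MvPolynomial.C ((u⁻¹ : ℂˣ) : ℂ) * (u • a) i = a i := by
    rw [Pi.smul_apply, Units.smul_def, ← MvPolynomial.smul_eq_C_mul, smul_smul]
    simp
  rwa [h2] at h

/-! ### Foliations -/

/-- The set `𝓕(2; N)` of foliations of degree `N` on the projective plane: classes, up to a nonzero
constant, of the `1`-forms in `FormSpace N` whose components have no common factor. -/
def Foliation (N : ℕ) : Type :=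
  {p : ℙ ℂ (FormSpace N) // NoCommonFactor p.rep.1}

theorem noCommonFactor_rep_mk {N : ℕ} {ω : FormSpace N} (h0 : ω ≠ 0) (h : NoCommonFactor ω.1) :
    NoCommonFactor (Projectivization.mk ℂ ω h0).rep.1 := by
  obtain ⟨u, hu⟩ := Projectivization.exists_smul_eq_mk_rep ℂ ω h0
  rw [← hu]
  exact h.smul u

theorem NoCommonFactor.ne_zero {N : ℕ} {ω : FormSpace N} (h : NoCommonFactor ω.1) : ω ≠ 0 := by
  rintro rfl
  exact not_isUnit_zero (h 0 fun _ => dvd_rfl)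

/-- The foliation defined by a `1`-form whose components have no common factor. -/
noncomputable def Foliation.ofForm {N : ℕ} (ω : FormSpace N) (h : NoCommonFactor ω.1) :
    Foliation N :=
  ⟨Projectivization.mk ℂ ω h.ne_zero, noCommonFactor_rep_mk h.ne_zero h⟩

/-- The ordinary topology of the projective space of `1`-forms: the quotient topology. -/
noncomputable instance (N : ℕ) : TopologicalSpace (ℙ ℂ (FormSpace N)) :=
  TopologicalSpace.coinduced (Projectivization.mk' ℂ : {ω : FormSpace N // ω ≠ 0} → _)
    inferInstance

/-- The ordinary topology of `𝓕(2; N)`, as a subspace of the projective space of `1`-forms. -/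
noncomputable instance (N : ℕ) : TopologicalSpace (Foliation N) :=
  inferInstanceAs (TopologicalSpace {p : ℙ ℂ (FormSpace N) // NoCommonFactor p.rep.1})

theorem noCommonFactor_rep_smul {N : ℕ} (g : GL (Fin 3) ℂ) (F : Foliation N) :
    NoCommonFactor (g • F.1).rep.1 := by
  have h : g • F.1 = Projectivization.mk ℂ (g • F.1.rep)
      ((smul_ne_zero_iff_ne g).mpr F.1.rep_nonzero) := by
    conv_lhs => rw [← F.1.mk_rep]
    rfl
  rw [h]
  exact noCommonFactor_rep_mk _ (F.2.pullbackFun g⁻¹)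

noncomputable instance (N : ℕ) : MulAction (GL (Fin 3) ℂ) (Foliation N) where
  smul g F := ⟨g • F.1, noCommonFactor_rep_smul g F⟩
  one_smul F := Subtype.ext (one_smul _ F.1)
  mul_smul g h F := Subtype.ext (mul_smul g h F.1)

/-- The action of `Aut(ℙ²(ℂ)) = PGL(3, ℂ)` on foliations, induced by `g • ω = (g⁻¹)^* ω`. -/
noncomputable instance (N : ℕ) : MulAction (Matrix.ProjGenLinGroup (Fin 3) ℂ) (Foliation N) :=
  Matrix.ProjGenLinGroup.mulActionOfGL fun u F => by
    apply Subtype.ext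
    change Matrix.GeneralLinearGroup.scalar (Fin 3) u • F.1 = F.1
    induction F.1 using Projectivization.ind with
    | h ω hω =>
      rw [Projectivization.smul_mk, Projectivization.mk_eq_mk_iff]
      exact ⟨u⁻¹ ^ (N + 2), (scalar_smul u ω).symm⟩

/-- The orbit `𝓞(F)` of a foliation under `Aut(ℙ²(ℂ)) = PGL(3, ℂ)`. -/
def orbit {N : ℕ} (F : Foliation N) : Set (Foliation N) :=
  MulAction.orbit (Matrix.ProjGenLinGroup (Fin 3) ℂ) F

/-! ### Dimension -/

/-- `S` is a complex submanifold of dimension `k` of the complex normed space `E`: near each of its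
points a biholomorphic change of coordinates maps `S` to a linear subspace of dimension `k`. -/
def IsComplexSubmanifold {E : Type*} [NormedAddCommGroup E] [NormedSpace ℂ E]
    (S : Set E) (k : ℕ) : Prop :=
  ∀ p ∈ S, ∃ (φ : OpenPartialHomeomorph E E) (W : Submodule ℂ E),
    p ∈ φ.source ∧ DifferentiableOn ℂ φ φ.source ∧ DifferentiableOn ℂ φ.symm φ.target ∧
    Module.finrank ℂ W = k ∧ ∀ x ∈ φ.source, x ∈ S ↔ φ x ∈ W

/-- The cone of all `1`-forms defining the foliations in `S`, that is, the preimage of `S` under the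
projection from the nonzero `1`-forms to the projective space of `1`-forms. -/
def cone {N : ℕ} (S : Set (Foliation N)) : Set (FormSpace N) :=
  {ω | ∃ h : ω ≠ 0, ∃ F ∈ S, F.1 = Projectivization.mk ℂ ω h}

/-- `S` is a complex submanifold of dimension `d` of `𝓕(2; N)`. As the projection from the nonzero
`1`-forms to their projective space is a holomorphic submersion with fibres of dimension one, this
means that the preimage of `S` is a complex submanifold of dimension `d + 1`. -/
def HasDimension {N : ℕ} (S : Set (Foliation N)) (d : ℕ) : Prop :=
  IsComplexSubmanifold (cone S) (d + 1)

/-! ### Pencils of conics -/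

/-- The components of the `1`-form `Q₂ dQ₁ - Q₁ dQ₂ = Q₂² d(Q₁ / Q₂)`. -/
noncomputable def pencilFun (Q₁ Q₂ : Poly) : Fin 3 → Poly :=
  fun i => Q₂ * MvPolynomial.pderiv i Q₁ - Q₁ * MvPolynomial.pderiv i Q₂

theorem pencilFun_mem {Q₁ Q₂ : Poly} (h₁ : Q₁.IsHomogeneous 2) (h₂ : Q₂.IsHomogeneous 2) :
    pencilFun Q₁ Q₂ ∈ FormSpace 2 := by
  refine ⟨fun i => (h₂.mul h₁.pderiv).sub (h₁.mul h₂.pderiv), ?_⟩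
  have e₁ := h₁.sum_X_mul_pderiv
  have e₂ := h₂.sum_X_mul_pderiv
  rw [Fin.sum_univ_three] at e₁ e₂ ⊢
  simp only [pencilFun]
  linear_combination Q₂ * e₁ - Q₁ * e₂

/-- The `1`-form `Q₂ dQ₁ - Q₁ dQ₂` associated with two quadratic forms. -/
noncomputable def pencilForm (Q₁ Q₂ : Poly) (h₁ : Q₁.IsHomogeneous 2) (h₂ : Q₂.IsHomogeneous 2) :
    FormSpace 2 :=
  ⟨pencilFun Q₁ Q₂, pencilFun_mem h₁ h₂⟩

/-- The quadratic foliation `F` is given by a pencil of conics `Q₁ + λ Q₂`: there are linearly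
independent quadratic forms `Q₁`, `Q₂` such that `Q₁ / Q₂` is a first integral of `F`,
that is, `ω ∧ d(Q₁ / Q₂) = 0` for a `1`-form `ω` defining `F`. -/
def IsPencilOfConics (F : Foliation 2) : Prop :=
  ∃ Q₁ Q₂ : Poly, Q₁.IsHomogeneous 2 ∧ Q₂.IsHomogeneous 2 ∧ LinearIndependent ℂ ![Q₁, Q₂] ∧
    ∀ i j, F.1.rep.1 i * pencilFun Q₁ Q₂ j = F.1.rep.1 j * pencilFun Q₁ Q₂ i

/-! ### The three models -/

theorem isUnit_of_degreeOf_eq_zero {d : Poly} (h : ∀ i, MvPolynomial.degreeOf i d = 0)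
    (hd : d ≠ 0) : IsUnit d := by
  have h1 : d.totalDegree = 0 := by
    have h2 := MvPolynomial.totalDegree_le_degrees_card d
    have h3 : d.degrees = 0 := by
      ext i
      rw [← MvPolynomial.degreeOf_def, h i, Multiset.count_zero]
    simpa [h3] using h2
  rw [MvPolynomial.totalDegree_eq_zero_iff_eq_C] at h1
  rw [h1] at hd ⊢
  exact (IsUnit.mk0 _ fun h0 => hd (by rw [h0, map_zero])).map MvPolynomial.C

/-- A nonzero polynomial in which the variable `i` does not occur has no divisor in which it occurs. -/
theorem degreeOf_eq_zero_of_dvd {d f : Poly} {i : Fin 3} (h : d ∣ f) (hf : f ≠ 0)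
    (hi : MvPolynomial.degreeOf i f = 0) : MvPolynomial.degreeOf i d = 0 := by
  obtain ⟨g, rfl⟩ := h
  rw [MvPolynomial.degreeOf_mul_eq (left_ne_zero_of_mul hf) (right_ne_zero_of_mul hf)] at hi
  omega

/-- The `1`-form `ω₅ = -Y³ dX + (X² Z + X Y²) dY - X² Y dZ`,
which is `x² dy + y² (x dy - y dx)` in the affine chart `Z = 1`. -/
noncomputable def form₅ : FormSpace 2 :=
  ⟨![-(MvPolynomial.X 1 ^ 3), MvPolynomial.X 0 ^ 2 * MvPolynomial.X 2 +
      MvPolynomial.X 0 * MvPolynomial.X 1 ^ 2, -(MvPolynomial.X 0 ^ 2 * MvPolynomial.X 1)], by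
    have hX : ∀ i : Fin 3, (MvPolynomial.X i : Poly).IsHomogeneous 1 :=
      MvPolynomial.isHomogeneous_X ℂ
    refine ⟨fun i => ?_, ?_⟩
    · fin_cases i
      · exact ((hX 1).pow 3).neg
      · exact (((hX 0).pow 2).mul (hX 2)).add ((hX 0).mul ((hX 1).pow 2))
      · exact (((hX 0).pow 2).mul (hX 1)).neg
    · rw [Fin.sum_univ_three]
      simp
      ring⟩

theorem quadric₆ : (MvPolynomial.X 0 * (MvPolynomial.X 1 + MvPolynomial.X 2) : Poly).IsHomogeneous 2
    ∧ (MvPolynomial.X 1 * (MvPolynomial.X 0 + MvPolynomial.X 2) : Poly).IsHomogeneous 2 := by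
  have hX : ∀ i : Fin 3, (MvPolynomial.X i : Poly).IsHomogeneous 1 :=
    MvPolynomial.isHomogeneous_X ℂ
  exact ⟨(hX 0).mul ((hX 1).add (hX 2)), (hX 1).mul ((hX 0).add (hX 2))⟩

theorem quadric₇ : (MvPolynomial.X 0 * MvPolynomial.X 2 : Poly).IsHomogeneous 2
    ∧ (MvPolynomial.X 1 * (MvPolynomial.X 1 - MvPolynomial.X 0) : Poly).IsHomogeneous 2 := by
  have hX : ∀ i : Fin 3, (MvPolynomial.X i : Poly).IsHomogeneous 1 :=
    MvPolynomial.isHomogeneous_X ℂ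
  exact ⟨(hX 0).mul (hX 2), (hX 1).mul ((hX 1).sub (hX 0))⟩

/-- The `1`-form of the pencil `X (Y + Z) + λ Y (X + Z)`. -/
noncomputable def form₆ : FormSpace 2 := pencilForm _ _ quadric₆.1 quadric₆.2

/-- The `1`-form of the pencil `X Z + λ Y (Y - X)`. -/
noncomputable def form₇ : FormSpace 2 := pencilForm _ _ quadric₇.1 quadric₇.2

theorem form₆_val : form₆.1 = ![MvPolynomial.X 1 * MvPolynomial.X 2 *
      (MvPolynomial.X 1 + MvPolynomial.X 2),
    -(MvPolynomial.X 0 * MvPolynomial.X 2 * (MvPolynomial.X 0 + MvPolynomial.X 2)),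
    MvPolynomial.X 0 * MvPolynomial.X 1 * (MvPolynomial.X 0 - MvPolynomial.X 1)] := by
  funext i
  fin_cases i <;> simp [form₆, pencilForm, pencilFun, MvPolynomial.pderiv_X] <;>
    ring

theorem form₇_val : form₇.1 = ![MvPolynomial.X 1 ^ 2 * MvPolynomial.X 2,
    -(MvPolynomial.X 0 * MvPolynomial.X 2 * (2 * MvPolynomial.X 1 - MvPolynomial.X 0)),
    MvPolynomial.X 0 * MvPolynomial.X 1 * (MvPolynomial.X 1 - MvPolynomial.X 0)] := by
  funext i
  fin_cases i <;> simp [form₇, pencilForm, pencilFun, MvPolynomial.pderiv_X] <;>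
    ring

theorem ne_zero_of_eval {f : Poly} (v : Fin 3 → ℂ) (h : MvPolynomial.eval v f ≠ 0) : f ≠ 0 := by
  rintro rfl
  exact h (map_zero _)

theorem not_X_dvd {f : Poly} {i : Fin 3} (v : Fin 3 → ℂ) (hv : v i = 0)
    (h : MvPolynomial.eval v f ≠ 0) : ¬ (MvPolynomial.X i ∣ f) := by
  rintro ⟨g, rfl⟩
  simp [hv] at h

theorem X_dvd_of_prime {p f : Poly} {i : Fin 3} (hp : Prime p) (h : p ∣ MvPolynomial.X i)
    (hf : p ∣ f) : MvPolynomial.X i ∣ f :=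
  ((hp.irreducible.dvd_comm (MvPolynomial.X_prime).irreducible).mp h).trans hf

theorem noCommonFactor_of_prime {a : Fin 3 → Poly} (h0 : ∃ i, a i ≠ 0)
    (h : ∀ p : Poly, Prime p → ¬ ∀ i, p ∣ a i) : NoCommonFactor a := by
  intro d hd
  by_contra hu
  have hd0 : d ≠ 0 := by
    rintro rfl
    obtain ⟨i, hi⟩ := h0
    exact hi (zero_dvd_iff.mp (hd i))
  obtain ⟨p, hp, hpd⟩ := WfDvdMonoid.exists_irreducible_factor hu hd0
  exact h p hp.prime fun i => hpd.trans (hd i)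

theorem noCommonFactor₅ : NoCommonFactor form₅.1 := by
  refine noCommonFactor_of_prime ⟨0, ?_⟩ fun p hp h => ?_
  · simp [form₅]
  have h0 : p ∣ MvPolynomial.X 1 := hp.dvd_of_dvd_pow (dvd_neg.mp (h 0))
  exact not_X_dvd ![1, 0, 1] rfl (by simp [form₅]) (X_dvd_of_prime hp h0 (h 1))

theorem noCommonFactor₆ : NoCommonFactor form₆.1 := by
  intro d hd
  rw [form₆_val] at hd
  have key : ∀ i j k : Fin 3, i ≠ j → i ≠ k → ∀ c : ℂ,
      MvPolynomial.degreeOf i (MvPolynomial.X j * MvPolynomial.X k *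
        (MvPolynomial.X j + MvPolynomial.C c * MvPolynomial.X k) : Poly) = 0 := by
    intro i j k hj hk c
    have e1 : MvPolynomial.degreeOf i (MvPolynomial.X j : Poly) = 0 := by
      rw [MvPolynomial.degreeOf_X, if_neg hj]
    have e2 : MvPolynomial.degreeOf i (MvPolynomial.X k : Poly) = 0 := by
      rw [MvPolynomial.degreeOf_X, if_neg hk]
    have e3 := MvPolynomial.degreeOf_C_mul_le (MvPolynomial.X k : Poly) i c
    have e4 := MvPolynomial.degreeOf_add_le i (MvPolynomial.X j : Poly)
      (MvPolynomial.C c * MvPolynomial.X k)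
    have e5 := MvPolynomial.degreeOf_mul_le i (MvPolynomial.X j : Poly) (MvPolynomial.X k)
    have e6 := MvPolynomial.degreeOf_mul_le i (MvPolynomial.X j * MvPolynomial.X k : Poly)
      (MvPolynomial.X j + MvPolynomial.C c * MvPolynomial.X k)
    omega
  have d0 := hd 0
  have d1 := dvd_neg.mp (hd 1)
  have d2 := hd 2
  simp only [Matrix.cons_val] at d0 d1 d2
  have n0 : (MvPolynomial.X 1 * MvPolynomial.X 2 *
      (MvPolynomial.X 1 + MvPolynomial.X 2) : Poly) ≠ 0 :=
    ne_zero_of_eval ![0, 1, 1] (by simp)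
  have n1 : (MvPolynomial.X 0 * MvPolynomial.X 2 *
      (MvPolynomial.X 0 + MvPolynomial.X 2) : Poly) ≠ 0 :=
    ne_zero_of_eval ![1, 0, 1] (by simp)
  have n2 : (MvPolynomial.X 0 * MvPolynomial.X 1 *
      (MvPolynomial.X 0 - MvPolynomial.X 1) : Poly) ≠ 0 :=
    ne_zero_of_eval ![1, -1, 0] (by simp)
  refine isUnit_of_degreeOf_eq_zero (fun i => ?_) (ne_zero_of_dvd_ne_zero n0 d0)
  fin_cases i
  · exact degreeOf_eq_zero_of_dvd d0 n0 (by simpa using key 0 1 2 (by decide) (by decide) 1)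
  · exact degreeOf_eq_zero_of_dvd d1 n1 (by simpa using key 1 0 2 (by decide) (by decide) 1)
  · exact degreeOf_eq_zero_of_dvd d2 n2
      (by simpa [sub_eq_add_neg] using key 2 0 1 (by decide) (by decide) (-1))

theorem noCommonFactor₇ : NoCommonFactor form₇.1 := by
  rw [form₇_val]
  refine noCommonFactor_of_prime ⟨0, ?_⟩ fun p hp h => ?_
  · simp
  rcases hp.dvd_or_dvd (h 0) with h0 | h0
  · exact not_X_dvd ![1, 0, 1] rfl (by simp) (X_dvd_of_prime hp (hp.dvd_of_dvd_pow h0) (h 1))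
  · exact not_X_dvd ![1, 2, 0] rfl (by simp; norm_num) (X_dvd_of_prime hp h0 (h 2))

/-- The foliation `𝓕₅`, defined by `x² dy + y² (x dy - y dx)`. -/
noncomputable def F₅ : Foliation 2 := Foliation.ofForm form₅ noCommonFactor₅

/-- The foliation `𝓕₆` of the pencil `X (Y + Z) + λ Y (X + Z)`,
with the first integral `X (Y + Z) / (Y (X + Z))`. -/
noncomputable def F₆ : Foliation 2 := Foliation.ofForm form₆ noCommonFactor₆

/-- The foliation `𝓕₇` of the pencil `X Z + λ Y (Y - X)`,
with the first integral `X Z / (Y (Y - X))`. -/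
noncomputable def F₇ : Foliation 2 := Foliation.ofForm form₇ noCommonFactor₇

end PlaneFoliation

namespace PlaneFoliation

/-! The `1`-form `Q₂ dQ₁ - Q₁ dQ₂` is bilinear and alternating in the two conics. It therefore
defines a map from `Λ²` of the six-dimensional space of conics to the space of `1`-forms. Both
spaces have dimension 15 and the map is an isomorphism, with inverse `plucker`. Forms of pencils are
then exactly the decomposable bivectors. This is the cone of dimension 9 over the Grassmannian of
planes in `ℂ⁶`, and it is closed because it is given by the Plücker relations.

A form without common factor comes from a pencil with neither a double line nor a fixed line
(`NoCommonFactor.nondegenerate`). Such a pencil has a singular member, which is a pair of lines and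
may be taken to be `X Y`. Normalizing a second conic leads to one of the three models
(`Nondegenerate.mem_pencilOrbits`). Among foliations, the union of the three orbits is thus the
closed set of decomposable ones (`mem_pencilOrbits_iff`).

The orbits are told apart by the binary cubic `det (λ x + μ y)` on the pencil. It has three distinct
roots for `form₆`, exactly one double root for `form₇`, and a triple root for `form₅`. In terms of
invariants, these cases are nonzero discriminant, zero discriminant with nonzero Hessian, and zero
Hessian. Evaluated on rows of `plucker ω`, which lie in the pencil, these invariants are polynomials
in `ω`. They bound the closures from above, and curves of pencils whose cubic degenerates in a
prescribed way bound them from below.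

Scalar matrices act on forms by fourth powers, so the cone over an orbit is a `GL(3, ℂ)`-orbit of
forms. Near a model it is cut out by six Plücker relations and by 0, 1 or 2 further equations: none
for `form₆`, the discriminant for `form₇`, two Hessian coefficients for `form₅`. An explicit
unfolding of the model gives a right inverse to these equations (`isComplexSubmanifold_formOrbit`),
so the cones have dimensions 9, 8 and 7. -/

/-! ### Monomials in three variables -/

/-- The exponent of the monomial `X ^ i Y ^ j Z ^ k`. -/
noncomputable def mon (i j k : ℕ) : Fin 3 →₀ ℕ := Finsupp.equivFunOnFinite.symm ![i, j, k]

theorem mon_zero (i j k : ℕ) : mon i j k 0 = i := rfl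
theorem mon_one (i j k : ℕ) : mon i j k 1 = j := rfl
theorem mon_two (i j k : ℕ) : mon i j k 2 = k := rfl

theorem finsupp_fin_three_ext {d e : Fin 3 →₀ ℕ} (h0 : d 0 = e 0) (h1 : d 1 = e 1)
    (h2 : d 2 = e 2) : d = e := by
  ext i
  fin_cases i <;> assumption

theorem mon_eq (d : Fin 3 →₀ ℕ) : mon (d 0) (d 1) (d 2) = d :=
  finsupp_fin_three_ext rfl rfl rfl

theorem mon_inj {i j k i' j' k' : ℕ} :
    mon i j k = mon i' j' k' ↔ i = i' ∧ j = j' ∧ k = k' := by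
  refine ⟨fun h => ⟨?_, ?_, ?_⟩, ?_⟩
  · exact DFunLike.congr_fun h 0
  · exact DFunLike.congr_fun h 1
  · exact DFunLike.congr_fun h 2
  · rintro ⟨rfl, rfl, rfl⟩
    rfl

theorem mon_add (i j k i' j' k' : ℕ) :
    mon i j k + mon i' j' k' = mon (i + i') (j + j') (k + k') :=
  finsupp_fin_three_ext rfl rfl rfl

theorem single_zero_one : Finsupp.single (0 : Fin 3) 1 = mon 1 0 0 :=
  finsupp_fin_three_ext (by simp [mon_zero]) (by simp [mon_one]) (by simp [mon_two])

theorem single_one_one : Finsupp.single (1 : Fin 3) 1 = mon 0 1 0 :=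
  finsupp_fin_three_ext (by simp [mon_zero]) (by simp [mon_one]) (by simp [mon_two])

theorem single_two_one : Finsupp.single (2 : Fin 3) 1 = mon 0 0 1 :=
  finsupp_fin_three_ext (by simp [mon_zero]) (by simp [mon_one]) (by simp [mon_two])

theorem mon_sub (i j k i' j' k' : ℕ) :
    mon i j k - mon i' j' k' = mon (i - i') (j - j') (k - k') :=
  finsupp_fin_three_ext rfl rfl rfl

theorem X_zero_eq : (MvPolynomial.X 0 : Poly) = MvPolynomial.monomial (mon 1 0 0) 1 := by
  rw [← single_zero_one]; rfl

theorem X_one_eq : (MvPolynomial.X 1 : Poly) = MvPolynomial.monomial (mon 0 1 0) 1 := by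
  rw [← single_one_one]; rfl

theorem X_two_eq : (MvPolynomial.X 2 : Poly) = MvPolynomial.monomial (mon 0 0 1) 1 := by
  rw [← single_two_one]; rfl

theorem degree_mon (i j k : ℕ) : (mon i j k).degree = i + j + k := by
  rw [Finsupp.degree_eq_sum, Fin.sum_univ_three]
  rfl

/-! ### Quadratic forms -/

/-- The quadratic form with symmetric matrix `u 0`, `u 1`, `u 2` on the diagonal and `u 3`, `u 4`,
`u 5` in the places `01`, `02`, `12`. -/
noncomputable def conic (u : Fin 6 → ℂ) : Poly :=
  MvPolynomial.monomial (mon 2 0 0) (u 0) + MvPolynomial.monomial (mon 0 2 0) (u 1) +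
  MvPolynomial.monomial (mon 0 0 2) (u 2) + MvPolynomial.monomial (mon 1 1 0) (2 * u 3) +
  MvPolynomial.monomial (mon 1 0 1) (2 * u 4) + MvPolynomial.monomial (mon 0 1 1) (2 * u 5)

/-- The symmetric matrix of a quadratic form. -/
def symm (u : Fin 6 → ℂ) : Matrix (Fin 3) (Fin 3) ℂ :=
  !![u 0, u 3, u 4; u 3, u 1, u 5; u 4, u 5, u 2]

theorem conic_eq (u : Fin 6 → ℂ) :
    conic u = ∑ i, ∑ j, MvPolynomial.C (symm u i j) * (MvPolynomial.X i * MvPolynomial.X j) := by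
  simp only [Fin.sum_univ_three, symm, X_zero_eq, X_one_eq, X_two_eq, MvPolynomial.monomial_mul,
    mon_add, MvPolynomial.C_mul_monomial, conic]
  simp only [two_mul, map_add]
  simp
  ring

theorem conic_isHomogeneous (u : Fin 6 → ℂ) : (conic u).IsHomogeneous 2 := by
  have h : ∀ i j k : ℕ, i + j + k = 2 → ∀ c : ℂ,
      (MvPolynomial.monomial (mon i j k) c : Poly).IsHomogeneous 2 := fun i j k hd c =>
    MvPolynomial.isHomogeneous_monomial c (by rw [degree_mon, hd])
  exact (((((h _ _ _ rfl _).add (h _ _ _ rfl _)).add (h _ _ _ rfl _)).add (h _ _ _ rfl _)).add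
    (h _ _ _ rfl _)).add (h _ _ _ rfl _)

theorem exists_conic_eq {Q : Poly} (hQ : Q.IsHomogeneous 2) : ∃ u, Q = conic u := by
  refine ⟨![Q.coeff (mon 2 0 0), Q.coeff (mon 0 2 0), Q.coeff (mon 0 0 2),
    Q.coeff (mon 1 1 0) / 2, Q.coeff (mon 1 0 1) / 2, Q.coeff (mon 0 1 1) / 2], ?_⟩
  ext d
  by_cases hd : d.degree = 2
  · obtain ⟨i, j, k, rfl⟩ : ∃ i j k, d = mon i j k := ⟨_, _, _, (mon_eq d).symm⟩
    rw [degree_mon] at hd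
    obtain ⟨hi, hj⟩ : i ≤ 2 ∧ j ≤ 2 := by omega
    obtain rfl : k = 2 - i - j := by omega
    interval_cases i <;> interval_cases j <;>
      first
      | omega
      | simp [conic, MvPolynomial.coeff_monomial, mon_inj, mul_div_cancel₀]
  · rw [hQ.coeff_eq_zero hd, (conic_isHomogeneous _).coeff_eq_zero hd]

theorem conic_add (u v : Fin 6 → ℂ) : conic (u + v) = conic u + conic v := by
  simp only [conic, Pi.add_apply, mul_add, map_add]
  ring

theorem conic_smul (c : ℂ) (u : Fin 6 → ℂ) : conic (c • u) = c • conic u := by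
  simp only [conic, Pi.smul_apply, smul_eq_mul, smul_add, MvPolynomial.smul_monomial,
    mul_left_comm]

/-- The `1`-form of the pencil of two quadratic forms. -/
noncomputable def pform (u v : Fin 6 → ℂ) : FormSpace 2 :=
  pencilForm (conic u) (conic v) (conic_isHomogeneous u) (conic_isHomogeneous v)

theorem pform_val (u v : Fin 6 → ℂ) : (pform u v).1 = pencilFun (conic u) (conic v) := rfl

theorem pencilFun_comb (a b c d : ℂ) (Q₁ Q₂ : Poly) :
    pencilFun (a • Q₁ + b • Q₂) (c • Q₁ + d • Q₂) = (a * d - b * c) • pencilFun Q₁ Q₂ := by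
  funext i
  simp only [pencilFun, map_add, Derivation.map_smul, Pi.smul_apply]
  simp only [MvPolynomial.smul_eq_C_mul, map_sub, map_mul]
  ring

theorem pform_comb (a b c d : ℂ) (u v : Fin 6 → ℂ) :
    pform (a • u + b • v) (c • u + d • v) = (a * d - b * c) • pform u v := by
  apply Subtype.ext
  simp only [pform_val, conic_add, conic_smul, pencilFun_comb]
  rfl

/-! ### Coordinates on the space of forms -/

/-- A coefficient of a `1`-form, as a linear functional. -/
noncomputable def formCoeff (l : Fin 3) (i j k : ℕ) : FormSpace 2 →ₗ[ℂ] ℂ :=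
  MvPolynomial.lcoeff ℂ (mon i j k) ∘ₗ LinearMap.proj l ∘ₗ (FormSpace 2).subtype

theorem formCoeff_apply (l : Fin 3) (i j k : ℕ) (ω : FormSpace 2) :
    formCoeff l i j k ω = (ω.1 l).coeff (mon i j k) := rfl

/-- The entries above the diagonal of the antisymmetric matrix `plucker`. -/
noncomputable def upper : Fin 6 → Fin 6 → FormSpace 2 →ₗ[ℂ] ℂ :=
  ![![0, (2⁻¹ : ℂ) • formCoeff 0 1 2 0, (2⁻¹ : ℂ) • formCoeff 0 1 0 2,
      (2⁻¹ : ℂ) • formCoeff 0 2 1 0, (2⁻¹ : ℂ) • formCoeff 0 2 0 1,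
      (4⁻¹ : ℂ) • formCoeff 0 1 1 1],
    ![0, 0, (2⁻¹ : ℂ) • formCoeff 1 0 1 2, (2⁻¹ : ℂ) • formCoeff 1 1 2 0,
      (4⁻¹ : ℂ) • formCoeff 1 1 1 1, (2⁻¹ : ℂ) • formCoeff 1 0 2 1],
    ![0, 0, 0, (4⁻¹ : ℂ) • formCoeff 2 1 1 1, (2⁻¹ : ℂ) • formCoeff 2 1 0 2,
      (2⁻¹ : ℂ) • formCoeff 2 0 1 2],
    -- The pairs `X Y`, `X Z` and `X²`, `Y Z` contribute to the same coefficients. The difference of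
    -- the two coefficients used here cancels the second contribution; the next two entries follow
    -- the same pattern.
    ![0, 0, 0, 0, (8⁻¹ : ℂ) • (formCoeff 1 2 0 1 - formCoeff 2 2 1 0),
      (8⁻¹ : ℂ) • (formCoeff 0 0 2 1 - formCoeff 2 1 2 0)],
    ![0, 0, 0, 0, 0, (8⁻¹ : ℂ) • (formCoeff 0 0 1 2 - formCoeff 1 1 0 2)],
    ![0, 0, 0, 0, 0, 0]]

/-- The coordinates of a `1`-form with respect to the forms `pform` of pairs of basis vectors. -/
noncomputable def plucker : FormSpace 2 →ₗ[ℂ] Fin 6 → Fin 6 → ℂ :=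
  LinearMap.pi fun α => LinearMap.pi fun β => upper α β - upper β α

theorem plucker_apply (ω : FormSpace 2) (α β : Fin 6) :
    plucker ω α β = upper α β ω - upper β α ω := rfl

theorem plucker_antisymm (ω : FormSpace 2) (α β : Fin 6) :
    plucker ω α β = -plucker ω β α := by
  simp only [plucker_apply, neg_sub]

/-- This identifies the form of a pencil with the bivector `u ∧ v`. The weights in `upper` are
chosen to make it hold. -/
theorem plucker_pform (u v : Fin 6 → ℂ) (α β : Fin 6) :
    plucker (pform u v) α β = u α * v β - u β * v α := by
  have key : ∀ α β : Fin 6, α < β → plucker (pform u v) α β = u α * v β - u β * v α := by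
    intro α β h
    fin_cases α <;> fin_cases β <;>
      first
      | exact absurd h (by decide)
      | simp [plucker_apply, upper, formCoeff_apply, pform_val, pencilFun, conic, MvPolynomial.pderiv_monomial, mon_zero,
          mon_one, mon_two, single_zero_one, single_one_one, single_two_one, mon_sub, mul_add,
          add_mul, MvPolynomial.monomial_mul, mon_add, MvPolynomial.coeff_monomial, mon_inj]
        ring
  rcases lt_trichotomy α β with h | rfl | h
  · exact key _ _ h
  · have := plucker_antisymm (pform u v) α α
    linear_combination this / 2
  · rw [plucker_antisymm, key _ _ h]
    ring

theorem formCoeff_euler (ω : FormSpace 2) (i j k : ℕ) :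
    (if i = 0 then 0 else formCoeff 0 (i - 1) j k ω) +
      (if j = 0 then 0 else formCoeff 1 i (j - 1) k ω) +
      (if k = 0 then 0 else formCoeff 2 i j (k - 1) ω) = 0 := by
  have h := congrArg (MvPolynomial.coeff (mon i j k)) ω.2.2
  rw [Fin.sum_univ_three] at h
  simp only [MvPolynomial.coeff_add, MvPolynomial.coeff_mul_X', Finsupp.mem_support_iff, mon_zero,
    mon_one, mon_two, single_zero_one, single_one_one, single_two_one, mon_sub,
    MvPolynomial.coeff_zero, ne_eq, ite_not, Nat.sub_zero] at h
  exact h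

/-- A triple of cubics has 30 coefficients. The 15 coordinates of `plucker` and the 15 coefficients
of the Euler relation `a X + b Y + c Z = 0` determine all of them. -/
theorem eq_zero_of_plucker_eq_zero {ω : FormSpace 2} (h : plucker ω = 0) : ω = 0 := by
  have e (α β : Fin 6) : upper α β ω - upper β α ω = 0 := congrFun (congrFun h α) β
  have h01 := e 0 1
  have h02 := e 0 2
  have h03 := e 0 3
  have h04 := e 0 4
  have h05 := e 0 5
  have h12 := e 1 2
  have h13 := e 1 3
  have h14 := e 1 4
  have h15 := e 1 5
  have h23 := e 2 3
  have h24 := e 2 4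
  have h25 := e 2 5
  have h34 := e 3 4
  have h35 := e 3 5
  have h45 := e 4 5
  clear e h
  simp [upper] at h01 h02 h03 h04 h05 h12 h13 h14 h15 h23 h24 h25 h34 h35 h45
  have E := formCoeff_euler ω
  have e400 := E 4 0 0
  have e040 := E 0 4 0
  have e004 := E 0 0 4
  have e310 := E 3 1 0
  have e301 := E 3 0 1
  have e130 := E 1 3 0
  have e031 := E 0 3 1
  have e103 := E 1 0 3
  have e013 := E 0 1 3
  have e220 := E 2 2 0
  have e202 := E 2 0 2
  have e022 := E 0 2 2
  have e211 := E 2 1 1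
  have e121 := E 1 2 1
  have e112 := E 1 1 2
  clear E
  simp [*] at e400 e040 e004 e310 e301 e130 e031 e103 e013 e220 e202 e022 e211 e121 e112
  -- In the multidegrees `(2,1,1)`, `(1,2,1)`, `(1,1,2)`, two coefficients remain. The Euler
  -- relation kills their sum and `plucker` their difference.
  have f1 : formCoeff 1 2 0 1 ω = 0 := by linear_combination (e211 + h34) / 2
  have f2 : formCoeff 2 2 1 0 ω = 0 := by linear_combination (e211 - h34) / 2
  have f3 : formCoeff 0 0 2 1 ω = 0 := by linear_combination (e121 + h35) / 2
  have f4 : formCoeff 2 1 2 0 ω = 0 := by linear_combination (e121 - h35) / 2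
  have f5 : formCoeff 0 0 1 2 ω = 0 := by linear_combination (e112 + h45) / 2
  have f6 : formCoeff 1 1 0 2 ω = 0 := by linear_combination (e112 - h45) / 2
  apply Subtype.ext
  funext l
  ext d
  change _ = (0 : ℂ)
  by_cases hd : d.degree = 3
  · obtain ⟨i, j, k, rfl⟩ : ∃ i j k, d = mon i j k := ⟨_, _, _, (mon_eq d).symm⟩
    rw [← formCoeff_apply]
    rw [degree_mon] at hd
    obtain ⟨hi, hj⟩ : i ≤ 3 ∧ j ≤ 3 := by omega
    obtain rfl : k = 3 - i - j := by omega
    interval_cases i <;> interval_cases j <;>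
      first
      | omega
      | (fin_cases l <;> assumption)
  · exact (ω.2.1 l).coeff_eq_zero hd

theorem plucker_injective : Function.Injective plucker := by
  rw [injective_iff_map_eq_zero]
  exact fun ω h => eq_zero_of_plucker_eq_zero h

/-- The pairs of indices `α < β`. -/
abbrev Pair : Type := {p : Fin 6 × Fin 6 // p.1 < p.2}

theorem card_pair : Fintype.card Pair = 15 := by decide

theorem plucker_pform_single (p : Pair) (α β : Fin 6) (h : α < β) :
    plucker (pform (Pi.single p.1.1 1) (Pi.single p.1.2 1)) α β = if p.1 = (α, β) then 1 else 0 := by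
  obtain ⟨⟨γ, δ⟩, hp⟩ := p
  rw [plucker_pform]
  simp only [Pi.single_apply, Prod.mk.injEq]
  dsimp only at hp
  by_cases h1 : γ = α <;> by_cases h2 : δ = β
  · subst h1 h2
    simp [hp.ne, hp.ne']
  · subst h1
    simp [h2, Ne.symm h2, h.ne']
  · subst h2
    simp [h1, Ne.symm h1, h.ne]
  · have : ¬ (β = γ ∧ α = δ) := by
      rintro ⟨rfl, rfl⟩
      exact absurd h (not_lt.mpr hp.le)
    simp only [Ne.symm h1, h1, if_false, zero_mul, zero_sub, false_and]
    by_cases h3 : β = γ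
    · rw [if_neg fun h4 => this ⟨h3, h4⟩, mul_zero, neg_zero]
    · rw [if_neg h3, zero_mul, neg_zero]

/-- The coordinates above the diagonal identify the space of `1`-forms with `ℂ¹⁵`. -/
noncomputable def pluckerEquiv : FormSpace 2 ≃ₗ[ℂ] (Pair → ℂ) :=
  LinearEquiv.ofBijective
    (LinearMap.pi fun p : Pair => LinearMap.proj p.1.2 ∘ₗ LinearMap.proj p.1.1 ∘ₗ plucker) <| by
  constructor
  · rw [injective_iff_map_eq_zero]
    intro ω h
    have key : ∀ α β : Fin 6, α < β → plucker ω α β = 0 := fun α β hαβ =>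
      congrFun h ⟨(α, β), hαβ⟩
    apply eq_zero_of_plucker_eq_zero
    funext α β
    rcases lt_trichotomy α β with h | rfl | h
    · exact key _ _ h
    · simp [plucker_apply]
    · rw [plucker_antisymm, key _ _ h, neg_zero]
      rfl
  · intro x
    refine ⟨∑ p : Pair, x p • pform (Pi.single p.1.1 1) (Pi.single p.1.2 1), ?_⟩
    rw [map_sum]
    funext q
    rw [Finset.sum_apply, Finset.sum_eq_single q]
    · simp only [map_smul, Pi.smul_apply]
      change _ • plucker _ _ _ = _
      rw [plucker_pform_single _ _ _ q.2]
      simp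
    · intro p _ hp
      simp only [map_smul, Pi.smul_apply]
      change _ • plucker _ _ _ = _
      rw [plucker_pform_single _ _ _ q.2, if_neg fun h => hp (Subtype.ext h), smul_zero]
    · simp

theorem pluckerEquiv_apply (ω : FormSpace 2) (p : Pair) :
    pluckerEquiv ω p = plucker ω p.1.1 p.1.2 := rfl

theorem finrank_formSpace : Module.finrank ℂ (FormSpace 2) = 15 := by
  rw [pluckerEquiv.finrank_eq, Module.finrank_fintype_fun_eq_card, card_pair]

/-! ### Linear substitutions in quadratic forms -/

/-- The quadratic form obtained from `u` by the linear substitution `φ`. -/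
def act (φ : Matrix (Fin 3) (Fin 3) ℂ) (u : Fin 6 → ℂ) : Fin 6 → ℂ :=
  let M := φ.transpose * symm u * φ
  ![M 0 0, M 1 1, M 2 2, M 0 1, M 0 2, M 1 2]

theorem symm_act (φ : Matrix (Fin 3) (Fin 3) ℂ) (u : Fin 6 → ℂ) :
    symm (act φ u) = φ.transpose * symm u * φ := by
  ext i j
  fin_cases i <;> fin_cases j <;>
    simp [act, symm, Matrix.mul_apply, Fin.sum_univ_three] <;> ring

theorem symm_injective : Function.Injective symm := by
  intro u v h
  have e (i j) := congrFun (congrFun h i) j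
  funext α
  fin_cases α
  exacts [e 0 0, e 1 1, e 2 2, e 0 1, e 0 2, e 1 2]

theorem act_mul (φ ψ : Matrix (Fin 3) (Fin 3) ℂ) (u : Fin 6 → ℂ) :
    act (φ * ψ) u = act ψ (act φ u) := by
  apply symm_injective
  simp only [symm_act, Matrix.transpose_mul, Matrix.mul_assoc]

theorem act_one (u : Fin 6 → ℂ) : act 1 u = u := by
  apply symm_injective
  simp only [symm_act, Matrix.transpose_one, Matrix.one_mul, Matrix.mul_one]

theorem conic_act (φ : Matrix (Fin 3) (Fin 3) ℂ) (u : Fin 6 → ℂ) :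
    conic (act φ u) = subst φ (conic u) := by
  rw [conic_eq, conic_eq, symm_act]
  simp only [map_mul, subst_C, subst_X, Fin.sum_univ_three, Matrix.mul_apply,
    Matrix.transpose_apply, map_add]
  ring

theorem pderiv_subst (φ : Matrix (Fin 3) (Fin 3) ℂ) (Q : Poly) (j : Fin 3) :
    MvPolynomial.pderiv j (subst φ Q) =
      ∑ i, MvPolynomial.C (φ i j) * subst φ (MvPolynomial.pderiv i Q) := by
  induction Q using MvPolynomial.induction_on with
  | C a => simp
  | add p q hp hq => simp only [map_add, hp, hq, mul_add, Finset.sum_add_distrib]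
  | mul_X p k hp =>
    simp only [map_mul, Derivation.leibniz, hp, smul_eq_mul, map_add, subst_X, mul_add,
      Finset.sum_add_distrib, MvPolynomial.pderiv_C, MvPolynomial.pderiv_X,
      Fin.sum_univ_three, Pi.single_apply]
    fin_cases k <;> fin_cases j <;> simp <;> ring

theorem pform_act (φ : Matrix (Fin 3) (Fin 3) ℂ) (u v : Fin 6 → ℂ) :
    pform (act φ u) (act φ v) = pullback φ (pform u v) := by
  apply Subtype.ext
  funext j
  change pencilFun _ _ j = pullbackFun φ (pencilFun _ _) j
  simp only [pencilFun, pullbackFun, conic_act, pderiv_subst, map_sub, map_mul, mul_sub,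
    Finset.sum_sub_distrib, Finset.mul_sum, mul_left_comm]

/-- The product of two linear forms. -/
noncomputable def prodLin (l m : Fin 3 → ℂ) : Fin 6 → ℂ :=
  ![l 0 * m 0, l 1 * m 1, l 2 * m 2, (l 0 * m 1 + l 1 * m 0) / 2, (l 0 * m 2 + l 2 * m 0) / 2,
    (l 1 * m 2 + l 2 * m 1) / 2]

theorem symm_prodLin (l m : Fin 3 → ℂ) (i j : Fin 3) :
    symm (prodLin l m) i j = (l i * m j + l j * m i) / 2 := by
  fin_cases i <;> fin_cases j <;> simp [symm, prodLin] <;> ring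

theorem act_prodLin (φ : Matrix (Fin 3) (Fin 3) ℂ) (l m : Fin 3 → ℂ) :
    act φ (prodLin l m) = prodLin (Matrix.vecMul l φ) (Matrix.vecMul m φ) := by
  apply symm_injective
  ext i j
  rw [symm_act, symm_prodLin]
  simp only [Matrix.mul_apply, Fin.sum_univ_three, Matrix.transpose_apply, symm_prodLin,
    Matrix.vecMul_eq_sum, Finset.sum_apply, Pi.smul_apply, smul_eq_mul]
  ring

/-- The linear form with given coefficients. -/
noncomputable def lin (l : Fin 3 → ℂ) : Poly := ∑ i, MvPolynomial.C (l i) * MvPolynomial.X i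

theorem conic_prodLin (l m : Fin 3 → ℂ) : conic (prodLin l m) = lin l * lin m := by
  have h2 : (MvPolynomial.C 2⁻¹ : Poly) * 2 = 1 := by
    rw [← map_ofNat MvPolynomial.C 2, ← map_mul, inv_mul_cancel₀ two_ne_zero, map_one]
  rw [conic_eq]
  simp only [symm_prodLin, lin, Fin.sum_univ_three, div_eq_mul_inv, map_mul, map_add]
  linear_combination (MvPolynomial.C (l 0) * MvPolynomial.X 0 + MvPolynomial.C (l 1) *
    MvPolynomial.X 1 + MvPolynomial.C (l 2) * MvPolynomial.X 2) * (MvPolynomial.C (m 0) *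
    MvPolynomial.X 0 + MvPolynomial.C (m 1) * MvPolynomial.X 1 + MvPolynomial.C (m 2) *
    MvPolynomial.X 2) * h2

theorem not_isUnit_lin (l : Fin 3 → ℂ) : ¬ IsUnit (lin l) := by
  intro h
  have := h.map (MvPolynomial.eval (0 : Fin 3 → ℂ))
  simp [lin] at this

/-- A `1`-form is nondegenerate if it does not come from a pencil of conics with a double line or
with a fixed line. -/
def Nondegenerate (ω : FormSpace 2) : Prop :=
  (∀ l v, ω ≠ pform (prodLin l l) v) ∧ ∀ l m n, ω ≠ pform (prodLin l m) (prodLin l n)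

/-- A linear form whose square belongs to the pencil, or which divides all of its members, divides
every component of the `1`-form. -/
theorem NoCommonFactor.nondegenerate {ω : FormSpace 2} (h : NoCommonFactor ω.1) :
    Nondegenerate ω := by
  constructor
  · rintro l v rfl
    refine not_isUnit_lin l (h (lin l) fun i => ?_)
    rw [pform_val]
    simp only [pencilFun, conic_prodLin, Derivation.leibniz, smul_eq_mul]
    exact ⟨conic v * 2 * MvPolynomial.pderiv i (lin l) - lin l * MvPolynomial.pderiv i (conic v),
      by ring⟩
  · rintro l m n rfl
    refine not_isUnit_lin l (h (lin l) fun i => ?_)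
    rw [pform_val]
    simp only [pencilFun, conic_prodLin, Derivation.leibniz, smul_eq_mul]
    exact ⟨lin n * (lin l * MvPolynomial.pderiv i (lin m) + lin m * MvPolynomial.pderiv i (lin l)) -
      lin m * (lin l * MvPolynomial.pderiv i (lin n) + lin n * MvPolynomial.pderiv i (lin l)),
      by ring⟩

/-! ### Orbits of forms -/

/-- The orbit of a `1`-form under `GL(3, ℂ)`. -/
abbrev formOrbit (ω : FormSpace 2) : Set (FormSpace 2) := MulAction.orbit (GL (Fin 3) ℂ) ω

theorem mem_formOrbit_symm {ω η : FormSpace 2} (h : ω ∈ formOrbit η) : η ∈ formOrbit ω :=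
  MulAction.mem_orbit_symm.mp h

theorem mem_formOrbit_trans {ω η θ : FormSpace 2} (h : ω ∈ formOrbit η) (h' : η ∈ formOrbit θ) :
    ω ∈ formOrbit θ := by
  obtain ⟨g, rfl⟩ := h
  obtain ⟨k, rfl⟩ := h'
  exact ⟨g * k, mul_smul g k θ⟩

/-- A scalar matrix acts through a fourth power, and every complex number is one; hence orbits of
forms are stable under nonzero scalars. -/
theorem smul_mem_formOrbit {c : ℂ} (hc : c ≠ 0) (ω : FormSpace 2) : c • ω ∈ formOrbit ω := by
  obtain ⟨z, hz⟩ := IsAlgClosed.exists_pow_nat_eq c (n := 4) (by norm_num)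
  have hz0 : z ≠ 0 := by
    rintro rfl
    exact hc (by rw [← hz]; norm_num)
  refine ⟨Matrix.GeneralLinearGroup.scalar (Fin 3) (Units.mk0 z hz0)⁻¹, ?_⟩
  change Matrix.GeneralLinearGroup.scalar (Fin 3) (Units.mk0 z hz0)⁻¹ • ω = _
  rw [scalar_smul, inv_inv, Units.smul_def]
  simp [hz]

theorem pullback_mem_formOrbit {φ : Matrix (Fin 3) (Fin 3) ℂ} (hφ : φ.det ≠ 0)
    (ω : FormSpace 2) : pullback φ ω ∈ formOrbit ω := by
  refine ⟨(Matrix.GeneralLinearGroup.mkOfDetNeZero φ hφ)⁻¹, ?_⟩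
  apply Subtype.ext
  change (_ • ω).1 = _
  rw [smul_val, inv_inv]
  rfl

theorem exists_of_mem_formOrbit {ω η : FormSpace 2} (h : ω ∈ formOrbit η) :
    ∃ φ : Matrix (Fin 3) (Fin 3) ℂ, φ.det ≠ 0 ∧ ω = pullback φ η := by
  obtain ⟨g, rfl⟩ := h
  exact ⟨(g⁻¹ : GL (Fin 3) ℂ).1, (Matrix.isUnits_det_units g⁻¹).ne_zero, rfl⟩

/-- If a substitution carries the pencil of `u₀`, `v₀` into the pencil of `u`, `v`, then the forms of
the two pencils are in the same orbit. -/
theorem pform_mem_formOrbit {φ : Matrix (Fin 3) (Fin 3) ℂ} (hφ : φ.det ≠ 0) {u v u₀ v₀ : Fin 6 → ℂ}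
    {a b c d : ℂ} (hu : act φ u₀ = a • u + b • v) (hv : act φ v₀ = c • u + d • v)
    (h : a * d - b * c ≠ 0) : pform u v ∈ formOrbit (pform u₀ v₀) := by
  have h1 := pullback_mem_formOrbit hφ (pform u₀ v₀)
  rw [← pform_act, hu, hv, pform_comb] at h1
  exact mem_formOrbit_trans (mem_formOrbit_symm (smul_mem_formOrbit h _)) h1

theorem Nondegenerate.of_mem_formOrbit {ω η : FormSpace 2} (h : Nondegenerate ω)
    (hη : η ∈ formOrbit ω) : Nondegenerate η := by
  obtain ⟨φ, -, hφ⟩ := exists_of_mem_formOrbit (mem_formOrbit_symm hη)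
  constructor
  · rintro l v rfl
    rw [← pform_act, act_prodLin] at hφ
    exact h.1 _ _ hφ
  · rintro l m n rfl
    rw [← pform_act, act_prodLin, act_prodLin] at hφ
    exact h.2 _ _ _ hφ

/-! ### The models -/

theorem form₅_eq : form₅ = pform (prodLin ![0, 1, 0] ![0, 1, 0] - prodLin ![1, 0, 0] ![0, 0, 1])
    (prodLin ![1, 0, 0] ![0, 1, 0]) := by
  apply Subtype.ext
  rw [pform_val, sub_eq_add_neg, ← neg_one_smul ℂ (prodLin _ ![0, 0, 1]), conic_add, conic_smul]
  simp only [conic_prodLin, lin, Fin.sum_univ_three]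
  funext i
  fin_cases i <;> simp [form₅, pencilFun, MvPolynomial.pderiv_X] <;> ring

theorem form₆_eq : form₆ = pform (prodLin ![1, 0, 0] ![0, 1, 1]) (prodLin ![0, 1, 0] ![1, 0, 1]) := by
  apply Subtype.ext
  rw [pform_val, conic_prodLin, conic_prodLin]
  simp [form₆, pencilForm, lin, Fin.sum_univ_three]

theorem form₇_eq : form₇ = pform (prodLin ![1, 0, 0] ![0, 0, 1])
    (prodLin ![0, 1, 0] ![-1, 1, 0]) := by
  apply Subtype.ext
  rw [pform_val, conic_prodLin, conic_prodLin]
  simp [form₇, pencilForm, lin, Fin.sum_univ_three, sub_eq_add_neg, add_comm]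

theorem act_sub (φ : Matrix (Fin 3) (Fin 3) ℂ) (u v : Fin 6 → ℂ) :
    act φ (u - v) = act φ u - act φ v := by
  funext α
  fin_cases α <;> simp [act, symm, Matrix.mul_apply, Fin.sum_univ_three] <;> ring

/-! ### Classification of the nondegenerate pencils of conics -/

/-- The three orbits of nondegenerate pencils of conics. -/
def pencilOrbits : Set (FormSpace 2) := formOrbit form₅ ∪ formOrbit form₆ ∪ formOrbit form₇

theorem mem_pencilOrbits_of_mem_formOrbit {ω η : FormSpace 2} (h : ω ∈ formOrbit η)
    (hη : η ∈ pencilOrbits) : ω ∈ pencilOrbits := by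
  rcases hη with (hη | hη) | hη
  · exact Or.inl (Or.inl (mem_formOrbit_trans h hη))
  · exact Or.inl (Or.inr (mem_formOrbit_trans h hη))
  · exact Or.inr (mem_formOrbit_trans h hη)

/-- The quadratic form `X Y`. -/
noncomputable def quadXY : Fin 6 → ℂ := prodLin ![1, 0, 0] ![0, 1, 0]

/-- The pencil of `X Y` and `d² X² + a² Y² + (p X + q Y + s Z)²`. -/
theorem formOrbit_square_sum {d a p q s r : ℂ} (hs : s ≠ 0)
    (h : Nondegenerate (pform quadXY
      ![d ^ 2 + p ^ 2, a ^ 2 + q ^ 2, s ^ 2, r, p * s, q * s])) :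
    pform quadXY ![d ^ 2 + p ^ 2, a ^ 2 + q ^ 2, s ^ 2, r, p * s, q * s] ∈ pencilOrbits := by
  have hI := Complex.I_sq
  by_cases hd : d = 0
  · by_cases ha : a = 0
    · subst hd ha
      refine absurd ?_ (h.1 ![p, q, s] (-quadXY))
      -- With `L = p X + q Y + s Z`, the second conic is now `L²` modulo `X Y`, so the pencil
      -- contains a double line.
      have h1 : prodLin ![p, q, s] ![p, q, s] = (2 * (p * q - r)) • quadXY + (1 : ℂ) •
          ![0 ^ 2 + p ^ 2, 0 ^ 2 + q ^ 2, s ^ 2, r, p * s, q * s] := by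
        funext α
        fin_cases α <;> simp [quadXY, prodLin] <;> ring
      have h2 : -quadXY = (-1 : ℂ) • quadXY + (0 : ℂ) •
          ![0 ^ 2 + p ^ 2, 0 ^ 2 + q ^ 2, s ^ 2, r, p * s, q * s] := by
        simp
      rw [h1, h2, pform_comb]
      simp
    · subst hd
      right
      rw [form₇_eq]
      -- Put `L = p X + q Y + s Z`. The substitution `X ↦ 2aY`, `Y ↦ aY + iL`, `Z ↦ X` carries `X Z`
      -- to `2a X Y` and `Y (Y - X)` to `-(a² Y² + L²)`.
      refine pform_mem_formOrbit (φ := !![0, 2 * a, 0; Complex.I * p, a + Complex.I * q,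
        Complex.I * s; 1, 0, 0]) (a := 2 * a) (b := 0) (c := -2 * (p * q - r)) (d := -1) ?_ ?_ ?_ ?_
      · rw [Matrix.det_fin_three]
        simp [ha, hs]
      · rw [act_prodLin]
        funext α
        fin_cases α <;> simp [quadXY, prodLin, Matrix.vecMul_eq_sum, Fin.sum_univ_three] <;> ring
      · rw [act_prodLin]
        funext α
        fin_cases α <;> simp [quadXY, prodLin, Matrix.vecMul_eq_sum, Fin.sum_univ_three] <;>
          ring_nf <;> simp [hI] <;> ring
      · simp [ha]
  · by_cases ha : a = 0
    · subst ha
      right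
      rw [form₇_eq]
      refine pform_mem_formOrbit (φ := !![2 * d, 0, 0; d + Complex.I * p, Complex.I * q,
        Complex.I * s; 0, 1, 0]) (a := 2 * d) (b := 0) (c := -2 * (p * q - r)) (d := -1) ?_ ?_ ?_ ?_
      · rw [Matrix.det_fin_three]
        simp [hd, hs]
      · rw [act_prodLin]
        funext α
        fin_cases α <;> simp [quadXY, prodLin, Matrix.vecMul_eq_sum, Fin.sum_univ_three] <;> ring
      · rw [act_prodLin]
        funext α
        fin_cases α <;> simp [quadXY, prodLin, Matrix.vecMul_eq_sum, Fin.sum_univ_three] <;>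
          ring_nf <;> simp [hI] <;> ring
      · simp [hd]
    · left
      right
      rw [form₆_eq]
      -- With `L` as before, `X ↦ iL + dX + aY`, `Y ↦ iL + dX - aY`, `Z ↦ -2dX` carries the two
      -- generators of the model to `-L² - (dX ± aY)²`. These differ by a multiple of `X Y`.
      refine pform_mem_formOrbit (φ := !![d + Complex.I * p, a + Complex.I * q, Complex.I * s;
        d + Complex.I * p, -a + Complex.I * q, Complex.I * s; -2 * d, 0, 0])
        (a := -(2 * (p * q - r) + 2 * d * a)) (b := -1) (c := -(2 * (p * q - r) - 2 * d * a))
        (d := -1) ?_ ?_ ?_ ?_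
      · rw [Matrix.det_fin_three]
        have : (-4 : ℂ) * d * a * Complex.I * s ≠ 0 := by simp [hd, ha, hs]
        convert this using 1
        simp
        ring
      · rw [act_prodLin]
        funext α
        fin_cases α <;> simp [quadXY, prodLin, Matrix.vecMul_eq_sum, Fin.sum_univ_three] <;>
          ring_nf <;> simp [hI] <;> ring
      · rw [act_prodLin]
        funext α
        fin_cases α <;> simp [quadXY, prodLin, Matrix.vecMul_eq_sum, Fin.sum_univ_three] <;>
          ring_nf <;> simp [hI] <;> ring
      · have : (4 : ℂ) * d * a ≠ 0 := by simp [hd, ha]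
        convert this using 1
        ring

/-- The pencil of `X Y` and a conic through the point `(0 : 0 : 1)`. -/
theorem formOrbit_through_vertex {a b c e r : ℂ}
    (h : Nondegenerate (pform quadXY ![a, b, 0, r, c, e])) :
    pform quadXY ![a, b, 0, r, c, e] ∈ pencilOrbits := by
  by_cases hc : c = 0
  · by_cases he : e = 0
    · subst hc he
      -- The pencil involves only `X` and `Y`, and adding a multiple of `X Y` completes the second
      -- conic to the square of `p X + q Y`.
      obtain ⟨p, rfl⟩ := IsAlgClosed.exists_eq_mul_self a
      obtain ⟨q, rfl⟩ := IsAlgClosed.exists_eq_mul_self b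
      refine absurd ?_ (h.1 ![p, q, 0] (-quadXY))
      have h1 : prodLin ![p, q, 0] ![p, q, 0] = (2 * (p * q - r)) • quadXY + (1 : ℂ) •
          ![p * p, q * q, 0, r, 0, 0] := by
        funext α
        fin_cases α <;> simp [quadXY, prodLin] <;> ring
      have h2 : -quadXY = (-1 : ℂ) • quadXY + (0 : ℂ) • ![p * p, q * q, 0, r, 0, 0] := by
        simp
      rw [h1, h2, pform_comb]
      simp
    · subst hc
      obtain ⟨p, rfl⟩ := IsAlgClosed.exists_eq_mul_self a
      have hp : p ≠ 0 := by
        rintro rfl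
        refine h.2 ![0, 1, 0] ![1, 0, 0] ![2 * r, b, 2 * e] ?_
        congr 1 <;> funext α <;> fin_cases α <;> simp [quadXY, prodLin]
      left
      left
      rw [form₅_eq]
      -- The conic is tangent to the line `Y = 0` at the vertex. The substitution carries `Y² - X Z`
      -- to `p² X² + b Y² + 2e Y Z`, which is the conic modulo `X Y`.
      refine pform_mem_formOrbit (φ := !![0, -1, 0; p, 0, 0; 0, b, 2 * e])
        (a := -2 * r) (b := 1) (c := -p) (d := 0) ?_ ?_ ?_ ?_
      · rw [Matrix.det_fin_three]
        simp [hp, he]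
      · rw [act_sub, act_prodLin, act_prodLin]
        funext α
        fin_cases α <;> simp [quadXY, prodLin, Matrix.vecMul_eq_sum, Fin.sum_univ_three] <;> ring
      · rw [act_prodLin]
        funext α
        fin_cases α <;> simp [quadXY, prodLin, Matrix.vecMul_eq_sum, Fin.sum_univ_three] <;> ring
      · simp [hp]
  · by_cases he : e = 0
    · subst he
      obtain ⟨q, rfl⟩ := IsAlgClosed.exists_eq_mul_self b
      have hq : q ≠ 0 := by
        rintro rfl
        refine h.2 ![1, 0, 0] ![0, 1, 0] ![a, 2 * r, 2 * c] ?_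
        congr 1 <;> funext α <;> fin_cases α <;> simp [quadXY, prodLin]
      left
      left
      rw [form₅_eq]
      refine pform_mem_formOrbit (φ := !![-1, 0, 0; 0, q, 0; a, 0, 2 * c])
        (a := -2 * r) (b := 1) (c := -q) (d := 0) ?_ ?_ ?_ ?_
      · rw [Matrix.det_fin_three]
        simp [hq, hc]
      · rw [act_sub, act_prodLin, act_prodLin]
        funext α
        fin_cases α <;> simp [quadXY, prodLin, Matrix.vecMul_eq_sum, Fin.sum_univ_three] <;> ring
      · rw [act_prodLin]
        funext α
        fin_cases α <;> simp [quadXY, prodLin, Matrix.vecMul_eq_sum, Fin.sum_univ_three] <;> ring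
      · simp [hq]
    · right
      rw [form₇_eq]
      -- The tangent at the vertex, `c X + e Y = 0`, differs from both lines of `X Y`. It becomes
      -- the line `X = 0` of the model, and `Z` is chosen so that `X Z` becomes half of the conic
      -- modulo `X Y`.
      refine pform_mem_formOrbit (φ := !![c, e, 0; c, 0, 0; a / (2 * c), b / (2 * e), 1])
        (a := c * (b / (2 * e)) + e * (a / (2 * c)) - r) (b := 1 / 2) (c := -(c * e)) (d := 0)
        ?_ ?_ ?_ ?_
      · rw [Matrix.det_fin_three]
        simp [hc, he]
      · rw [act_prodLin]
        funext α
        fin_cases α <;> simp [quadXY, prodLin, Matrix.vecMul_eq_sum, Fin.sum_univ_three] <;>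
          field_simp <;> ring
      · rw [act_prodLin]
        funext α
        fin_cases α <;> simp [quadXY, prodLin, Matrix.vecMul_eq_sum, Fin.sum_univ_three] <;> ring
      · simp [hc, he]

theorem formOrbit_quadXY {v : Fin 6 → ℂ} (h : Nondegenerate (pform quadXY v)) :
    pform quadXY v ∈ pencilOrbits := by
  by_cases h2 : v 2 = 0
  · have hv : v = ![v 0, v 1, 0, v 3, v 4, v 5] := by
      funext α
      fin_cases α <;> simp [h2]
    rw [hv] at h ⊢
    exact formOrbit_through_vertex h
  · obtain ⟨s, hs⟩ := IsAlgClosed.exists_eq_mul_self (v 2)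
    have hs0 : s ≠ 0 := by
      rintro rfl
      exact h2 (by rw [hs, zero_mul])
    -- Completing the square in `Z` leaves a form in `X` and `Y`, whose `X²` and `Y²` coefficients
    -- are written as squares.
    obtain ⟨d, hd⟩ := IsAlgClosed.exists_eq_mul_self (v 0 - (v 4 / s) ^ 2)
    obtain ⟨a, ha⟩ := IsAlgClosed.exists_eq_mul_self (v 1 - (v 5 / s) ^ 2)
    have hv : v = ![d ^ 2 + (v 4 / s) ^ 2, a ^ 2 + (v 5 / s) ^ 2, s ^ 2, v 3, v 4 / s * s,
        v 5 / s * s] := by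
      funext α
      fin_cases α <;> simp [hs0, hs, sq]
      · linear_combination hd
      · linear_combination ha
    rw [hv] at h ⊢
    exact formOrbit_square_sum hs0 h

/-! ### Singular members of a pencil -/

/-- The determinant of the symmetric matrix of a quadratic form. -/
def quadDet (u : Fin 6 → ℂ) : ℂ :=
  u 0 * u 1 * u 2 + 2 * u 3 * u 4 * u 5 - u 0 * u 5 ^ 2 - u 1 * u 4 ^ 2 - u 2 * u 3 ^ 2

theorem det_symm (u : Fin 6 → ℂ) : (symm u).det = quadDet u := by
  rw [Matrix.det_fin_three]
  simp [symm, quadDet]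
  ring

theorem quadDet_act (φ : Matrix (Fin 3) (Fin 3) ℂ) (u : Fin 6 → ℂ) :
    quadDet (act φ u) = φ.det ^ 2 * quadDet u := by
  rw [← det_symm, symm_act, Matrix.det_mul, Matrix.det_mul, Matrix.det_transpose, det_symm]
  ring

/-- The derivative of `quadDet` at `u` in the direction `v`. -/
def quadDetMixed (u v : Fin 6 → ℂ) : ℂ :=
  v 0 * (u 1 * u 2 - u 5 ^ 2) + v 1 * (u 0 * u 2 - u 4 ^ 2) + v 2 * (u 0 * u 1 - u 3 ^ 2) +
    2 * v 3 * (u 4 * u 5 - u 2 * u 3) + 2 * v 4 * (u 3 * u 5 - u 1 * u 4) +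
    2 * v 5 * (u 3 * u 4 - u 0 * u 5)

theorem quadDet_comb (s t : ℂ) (u v : Fin 6 → ℂ) :
    quadDet (s • u + t • v) = s ^ 3 * quadDet u + s ^ 2 * t * quadDetMixed u v +
      s * t ^ 2 * quadDetMixed v u + t ^ 3 * quadDet v := by
  simp only [quadDet, quadDetMixed, Pi.add_apply, Pi.smul_apply, smul_eq_mul]
  ring

theorem exists_cubic_root {a : ℂ} (ha : a ≠ 0) (b c d : ℂ) :
    ∃ s : ℂ, a * s ^ 3 + b * s ^ 2 + c * s + d = 0 := by
  open Polynomial in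
  have h : (C a * X ^ 3 + C b * X ^ 2 + C c * X + C d : ℂ[X]).degree ≠ 0 := by
    rw [degree_cubic ha]
    decide
  obtain ⟨s, hs⟩ := IsAlgClosed.exists_root _ h
  exact ⟨s, by simpa [Polynomial.IsRoot] using hs⟩

/-- A singular quadratic form is a quadratic form in two variables. -/
theorem exists_act_of_quadDet_eq_zero {u : Fin 6 → ℂ} (hu : quadDet u = 0) :
    ∃ φ : Matrix (Fin 3) (Fin 3) ℂ, φ.det ≠ 0 ∧
      ∃ a b r : ℂ, act φ u = ![a, b, 0, r, 0, 0] := by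
  rw [← det_symm] at hu
  obtain ⟨w, hw0, hw⟩ := Matrix.exists_mulVec_eq_zero_iff.mpr hu
  -- A kernel vector of the symmetric matrix is completed to a basis. As the last basis vector, it
  -- makes the last variable disappear from the form.
  have key : ∃ φ : Matrix (Fin 3) (Fin 3) ℂ, φ.det ≠ 0 ∧ ∀ i, φ i 2 = w i := by
    by_cases h2 : w 2 = 0
    · by_cases h1 : w 1 = 0
      · have h0 : w 0 ≠ 0 := by
          intro h0
          apply hw0
          funext i
          fin_cases i <;> assumption
        refine ⟨!![0, 0, w 0; 1, 0, w 1; 0, 1, w 2], ?_, fun i => by fin_cases i <;> rfl⟩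
        rw [Matrix.det_fin_three]
        simp [h0]
      · refine ⟨!![1, 0, w 0; 0, 0, w 1; 0, 1, w 2], ?_, fun i => by fin_cases i <;> rfl⟩
        rw [Matrix.det_fin_three]
        simp [h1]
    · refine ⟨!![1, 0, w 0; 0, 1, w 1; 0, 0, w 2], ?_, fun i => by fin_cases i <;> rfl⟩
      rw [Matrix.det_fin_three]
      simp [h2]
  obtain ⟨φ, hφ, hcol⟩ := key
  have hz (i : Fin 3) : symm (act φ u) i 2 = 0 := by
    have h1 : (symm u * φ).col 2 = 0 := by
      rw [← hw]
      funext j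
      simp [Matrix.col, Matrix.mul_apply, Matrix.mulVec, dotProduct, hcol]
    rw [symm_act, Matrix.mul_assoc, Matrix.mul_apply]
    exact Finset.sum_eq_zero fun j _ => by
      rw [show (symm u * φ) j 2 = 0 from congrFun h1 j, mul_zero]
  refine ⟨φ, hφ, act φ u 0, act φ u 1, act φ u 3, ?_⟩
  funext α
  fin_cases α
  exacts [rfl, rfl, hz 2, rfl, hz 0, hz 1]

theorem act_inv_act {φ : Matrix (Fin 3) (Fin 3) ℂ} (hφ : φ.det ≠ 0) (u : Fin 6 → ℂ) :
    act φ (act φ⁻¹ u) = u := by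
  rw [← act_mul, Matrix.nonsing_inv_mul _ (isUnit_iff_ne_zero.mpr hφ), act_one]

theorem pform_eq_smul (s : ℂ) (u v : Fin 6 → ℂ) : pform (s • u) v = s • pform u v := by
  simpa using pform_comb s 0 0 1 u v

/-- A binary quadratic form splits into two linear factors over `ℂ`. They are independent, since a
double line is excluded. -/
theorem exists_formOrbit_quadXY {a b r : ℂ} {v : Fin 6 → ℂ}
    (h : Nondegenerate (pform ![a, b, 0, r, 0, 0] v)) :
    ∃ w, pform ![a, b, 0, r, 0, 0] v ∈ formOrbit (pform quadXY w) := by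
  have key : ∃ ψ : Matrix (Fin 3) (Fin 3) ℂ, ψ.det ≠ 0 ∧ ∃ c : ℂ, c ≠ 0 ∧
      act ψ quadXY = c • ![a, b, 0, r, 0, 0] := by
    by_cases ha : a = 0
    · subst ha
      have hr : r ≠ 0 := by
        rintro rfl
        obtain ⟨p, rfl⟩ := IsAlgClosed.exists_eq_mul_self b
        refine h.1 ![0, p, 0] v ?_
        congr 1
        funext α
        fin_cases α <;> simp [prodLin]
      refine ⟨!![2 * r, b, 0; 0, 1, 0; 0, 0, 1], ?_, 1, one_ne_zero, ?_⟩
      · rw [Matrix.det_fin_three]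
        simp [hr]
      · rw [quadXY, act_prodLin]
        funext α
        fin_cases α <;> simp [prodLin, Matrix.vecMul_eq_sum, Fin.sum_univ_three]
    · obtain ⟨t, ht⟩ := IsAlgClosed.exists_eq_mul_self (r ^ 2 - a * b)
      have ht0 : t ≠ 0 := by
        rintro rfl
        refine h.1 ![a, r, 0] (a⁻¹ • v) ?_
        have h1 : prodLin ![a, r, 0] ![a, r, 0] = a • ![a, b, 0, r, 0, 0] + (0 : ℂ) • v := by
          funext α
          fin_cases α <;> simp [prodLin]
          · linear_combination ht
          · ring
        have h2 : a⁻¹ • v = (0 : ℂ) • ![a, b, 0, r, 0, 0] + a⁻¹ • v := by simp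
        rw [h1, h2, pform_comb]
        simp [ha]
      -- `(aX + (r+t)Y)(aX + (r-t)Y) = a (aX² + 2rXY + bY²)`, because `t² = r² - ab`.
      refine ⟨!![a, r + t, 0; a, r - t, 0; 0, 0, 1], ?_, a, ha, ?_⟩
      · rw [Matrix.det_fin_three]
        have : -2 * a * t ≠ 0 := by simp [ha, ht0]
        convert this using 1
        simp
        ring
      · rw [quadXY, act_prodLin]
        funext α
        fin_cases α <;> simp [prodLin, Matrix.vecMul_eq_sum, Fin.sum_univ_three]
        · linear_combination ht
        · ring
  obtain ⟨ψ, hψ, c, hc, hact⟩ := key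
  refine ⟨act ψ⁻¹ v, pform_mem_formOrbit hψ (a := c) (b := 0) (c := 0) (d := 1) ?_ ?_ ?_⟩
  · rw [hact]
    simp
  · rw [act_inv_act hψ]
    simp
  · simpa using hc

theorem mem_pencilOrbits_of_quadDet_eq_zero {u v : Fin 6 → ℂ} (h : Nondegenerate (pform u v))
    (hu : quadDet u = 0) : pform u v ∈ pencilOrbits := by
  obtain ⟨φ, hφ, a, b, r, hact⟩ := exists_act_of_quadDet_eq_zero hu
  have h1 := pullback_mem_formOrbit hφ (pform u v)
  rw [← pform_act, hact] at h1
  have h2 := h.of_mem_formOrbit h1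
  obtain ⟨w, hw⟩ := exists_formOrbit_quadXY h2
  refine mem_pencilOrbits_of_mem_formOrbit (mem_formOrbit_trans (mem_formOrbit_symm h1) hw) ?_
  exact formOrbit_quadXY (h2.of_mem_formOrbit (mem_formOrbit_symm hw))

/-- A nondegenerate pencil of conics is conjugate to one of the three models. -/
theorem Nondegenerate.mem_pencilOrbits {u v : Fin 6 → ℂ} (h : Nondegenerate (pform u v)) :
    pform u v ∈ pencilOrbits := by
  by_cases hu : quadDet u = 0
  · exact mem_pencilOrbits_of_quadDet_eq_zero h hu
  -- `det (s u + v)` is a cubic in `s` with leading coefficient `det u ≠ 0`. At a root, `s u + v` is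
  -- singular; passing to the basis `s u + v`, `-u` has determinant 1 and keeps the form.
  · obtain ⟨s, hs⟩ := exists_cubic_root hu (quadDetMixed u v) (quadDetMixed v u) (quadDet v)
    have h1 : pform (s • u + (1 : ℂ) • v) ((-1 : ℂ) • u + (0 : ℂ) • v) = pform u v := by
      rw [pform_comb]
      simp
    rw [← h1] at h ⊢
    refine mem_pencilOrbits_of_quadDet_eq_zero h ?_
    rw [quadDet_comb]
    linear_combination hs

/-! ### From first integrals to forms of pencils -/

/-- A foliation which is given by a pencil of conics is defined by the form of the pencil. -/
theorem IsPencilOfConics.exists_rep_eq {F : Foliation 2} (h : IsPencilOfConics F) :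
    ∃ u v : Fin 6 → ℂ, F.1.rep = pform u v := by
  obtain ⟨Q₁, Q₂, h₁, h₂, hli, hF⟩ := h
  obtain ⟨u, rfl⟩ := exists_conic_eq h₁
  obtain ⟨v, rfl⟩ := exists_conic_eq h₂
  have hne : pform u v ≠ 0 := by
    intro h0
    have hp (α β : Fin 6) : u α * v β - u β * v α = 0 := by
      rw [← plucker_pform, h0]
      simp
    obtain ⟨α, hα⟩ : ∃ α, v α ≠ 0 := by
      by_contra! hv
      have h1 : conic v = 0 := by simp [conic, hv]
      exact hli.ne_zero 1 (by simpa using h1)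
    have h2 := (LinearIndependent.pair_iff.mp hli) (v α) (-u α) (by
      rw [← conic_smul, ← conic_smul, ← conic_add]
      have : v α • u + -u α • v = 0 := by
        funext β
        have := hp α β
        simp only [Pi.add_apply, Pi.smul_apply, smul_eq_mul, Pi.zero_apply]
        linear_combination -this
      rw [this]
      simp [conic])
    exact hα h2.1
  set ω := F.1.rep with hω
  have hncf : NoCommonFactor ω.1 := F.2
  have hη : ∀ i, (pform u v).1 i = pencilFun (conic u) (conic v) i := fun i => rfl
  obtain ⟨i₀, hi₀⟩ : ∃ i, ω.1 i ≠ 0 := by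
    by_contra! h0
    exact hncf.ne_zero (Subtype.ext (funext h0))
  -- By proportionality, `ω i₀` divides `ω j * η i₀` for every `j`, where `η` is the form of the
  -- pencil. Since the `ω j` have gcd 1, it divides `η i₀`.
  have hdvd : ω.1 i₀ ∣ (pform u v).1 i₀ := by
    let : GCDMonoid Poly := UniqueFactorizationMonoid.toGCDMonoid Poly
    have hd (j : Fin 3) : ω.1 i₀ ∣ ω.1 j * (pform u v).1 i₀ :=
      ⟨pencilFun (conic u) (conic v) j, by rw [hη, hF j i₀]⟩
    have hunit : IsUnit (gcd (gcd (ω.1 0) (ω.1 1)) (ω.1 2)) := by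
      apply hncf
      intro i
      fin_cases i
      · exact (gcd_dvd_left _ _).trans (gcd_dvd_left _ _)
      · exact (gcd_dvd_left _ _).trans (gcd_dvd_right _ _)
      · exact gcd_dvd_right _ _
    have h1 := dvd_gcd (hd 0) (hd 1)
    have h2 := h1.trans (gcd_mul_right' _ _ _).dvd
    have h3 := (dvd_gcd h2 (hd 2)).trans (gcd_mul_right' _ _ _).dvd
    rwa [hunit.dvd_mul_left] at h3
  obtain ⟨f, hf⟩ := hdvd
  have hall : ∀ j, (pform u v).1 j = f * ω.1 j := by
    intro j
    apply mul_left_cancel₀ hi₀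
    rw [hη, hF i₀ j, ← hη, hf]
    ring
  obtain ⟨j, hj⟩ : ∃ j, (pform u v).1 j ≠ 0 := by
    by_contra! h0
    exact hne (Subtype.ext (funext h0))
  have hf0 : f ≠ 0 := by
    rintro rfl
    exact hj (by rw [hall, zero_mul])
  have hωj : ω.1 j ≠ 0 := by
    intro h0
    exact hj (by rw [hall, h0, mul_zero])
  -- Both forms have components of degree 3, so the quotient is a constant.
  have hdeg : f.totalDegree = 0 := by
    have h1 := ((pform u v).2.1 j).totalDegree hj
    have h2 := (ω.2.1 j).totalDegree hωj
    rw [hall, MvPolynomial.totalDegree_mul_of_isDomain hf0 hωj] at h1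
    omega
  obtain ⟨c, hc⟩ : ∃ c, f = MvPolynomial.C c := ⟨_, MvPolynomial.totalDegree_eq_zero_iff_eq_C.mp hdeg⟩
  have hc0 : c ≠ 0 := by
    rintro rfl
    exact hf0 (by rw [hc, map_zero])
  refine ⟨c⁻¹ • u, v, ?_⟩
  rw [pform_eq_smul, eq_inv_smul_iff₀ hc0]
  apply Subtype.ext
  funext i
  rw [hall, hc, ← MvPolynomial.smul_eq_C_mul]
  rfl

/-! ### Invariants of pencils of conics -/

theorem act_comb (φ : Matrix (Fin 3) (Fin 3) ℂ) (s t : ℂ) (u v : Fin 6 → ℂ) :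
    act φ (s • u + t • v) = s • act φ u + t • act φ v := by
  funext α
  fin_cases α <;> simp [act, symm, Matrix.mul_apply, Fin.sum_univ_three] <;> ring

theorem quadDetMixed_comb (s t p q : ℂ) (u v : Fin 6 → ℂ) :
    quadDetMixed (s • u + t • v) (p • u + q • v) = 3 * s ^ 2 * p * quadDet u +
      (2 * s * t * p + s ^ 2 * q) * quadDetMixed u v +
      (t ^ 2 * p + 2 * s * t * q) * quadDetMixed v u + 3 * t ^ 2 * q * quadDet v := by
  simp only [quadDet, quadDetMixed, Pi.add_apply, Pi.smul_apply, smul_eq_mul]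
  ring

/-- Polarization of `quadDet_act`: half of `det (u + v) - det (u - v)`, minus `det v`, is the mixed
coefficient. -/
theorem quadDetMixed_act (φ : Matrix (Fin 3) (Fin 3) ℂ) (u v : Fin 6 → ℂ) :
    quadDetMixed (act φ u) (act φ v) = φ.det ^ 2 * quadDetMixed u v := by
  have key (s t : ℂ) := quadDet_act φ (s • u + t • v)
  simp only [act_comb, quadDet_comb] at key
  have h3 := quadDet_act φ v
  linear_combination (key 1 1 - key 1 (-1)) / 2 - h3

/-- The discriminant of the binary cubic form `det (λ x + μ y)`. -/
def disc (x y : Fin 6 → ℂ) : ℂ :=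
  quadDetMixed x y ^ 2 * quadDetMixed y x ^ 2 - 4 * quadDet x * quadDetMixed y x ^ 3 -
    4 * quadDetMixed x y ^ 3 * quadDet y - 27 * quadDet x ^ 2 * quadDet y ^ 2 +
    18 * quadDet x * quadDetMixed x y * quadDetMixed y x * quadDet y

/-- The first coefficient of the Hessian of the binary cubic form `det (λ x + μ y)`; the last one is
`hess y x`. -/
def hess (x y : Fin 6 → ℂ) : ℂ := quadDetMixed x y ^ 2 - 3 * quadDet x * quadDetMixed y x

/-- The middle coefficient of the Hessian of the binary cubic form `det (λ x + μ y)`. -/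
def hessMid (x y : Fin 6 → ℂ) : ℂ :=
  quadDetMixed x y * quadDetMixed y x - 9 * quadDet x * quadDet y

/-- Up to a constant, the discriminant of the Hessian of a binary cubic is the discriminant of the
cubic. In particular, a vanishing Hessian forces a vanishing discriminant. -/
theorem disc_eq_hess (x y : Fin 6 → ℂ) :
    3 * disc x y = 4 * hess x y * hess y x - hessMid x y ^ 2 := by
  simp only [disc, hess, hessMid]
  ring

/-- The rows are members of the pencil, so invariants of the pencil become polynomials in the
coefficients of `ω`. Rows `α`, `β` form a basis of it when the entry `α β` is nonzero. -/
theorem plucker_row (u v : Fin 6 → ℂ) (α : Fin 6) :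
    plucker (pform u v) α = (-v α) • u + u α • v := by
  funext β
  rw [plucker_pform]
  simp only [Pi.add_apply, Pi.smul_apply, smul_eq_mul]
  ring

/-- The binary cubic form of two rows of the matrix `plucker ω`, for `ω` in the orbit of a pencil. -/
theorem exists_cubic_of_mem_formOrbit {ω : FormSpace 2} {u₀ v₀ : Fin 6 → ℂ}
    (h : ω ∈ formOrbit (pform u₀ v₀)) :
    ∃ k : ℂ, k ≠ 0 ∧ ∀ α β : Fin 6, ∃ s t p q : ℂ, s * q - t * p = plucker ω α β ∧
      quadDet (plucker ω α) = k * (s ^ 3 * quadDet u₀ + s ^ 2 * t * quadDetMixed u₀ v₀ +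
        s * t ^ 2 * quadDetMixed v₀ u₀ + t ^ 3 * quadDet v₀) ∧
      quadDetMixed (plucker ω α) (plucker ω β) = k * (3 * s ^ 2 * p * quadDet u₀ +
        (2 * s * t * p + s ^ 2 * q) * quadDetMixed u₀ v₀ +
        (t ^ 2 * p + 2 * s * t * q) * quadDetMixed v₀ u₀ + 3 * t ^ 2 * q * quadDet v₀) ∧
      quadDetMixed (plucker ω β) (plucker ω α) = k * (3 * p ^ 2 * s * quadDet u₀ +
        (2 * p * q * s + p ^ 2 * t) * quadDetMixed u₀ v₀ +
        (q ^ 2 * s + 2 * p * q * t) * quadDetMixed v₀ u₀ + 3 * q ^ 2 * t * quadDet v₀) ∧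
      quadDet (plucker ω β) = k * (p ^ 3 * quadDet u₀ + p ^ 2 * q * quadDetMixed u₀ v₀ +
        p * q ^ 2 * quadDetMixed v₀ u₀ + q ^ 3 * quadDet v₀) := by
  obtain ⟨φ, hφ, rfl⟩ := exists_of_mem_formOrbit h
  rw [← pform_act]
  -- By `plucker_row`, `(s, t)` and `(p, q)` are the coordinates of the two rows in the substituted
  -- basis. The substitution itself multiplies determinants by `φ.det ^ 2`.
  refine ⟨φ.det ^ 2, pow_ne_zero _ hφ, fun α β => ⟨-act φ v₀ α, act φ u₀ α, -act φ v₀ β,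
    act φ u₀ β, ?_, ?_, ?_, ?_, ?_⟩⟩
  · rw [plucker_pform]
    ring
  all_goals
    simp only [plucker_row, quadDet_comb, quadDetMixed_comb, quadDetMixed_act, quadDet_act]
    ring

/-- The cubics of the three models are `-s³/4` here, then `st(s + t)/4` for `form₆` and `-s²t/4` for
`form₇`. -/
theorem invariants_form₅ :
    quadDet (prodLin ![0, 1, 0] ![0, 1, 0] - prodLin ![1, 0, 0] ![0, 0, 1]) = -1 / 4 ∧
    quadDetMixed (prodLin ![0, 1, 0] ![0, 1, 0] - prodLin ![1, 0, 0] ![0, 0, 1])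
      (prodLin ![1, 0, 0] ![0, 1, 0]) = 0 ∧
    quadDetMixed (prodLin ![1, 0, 0] ![0, 1, 0])
      (prodLin ![0, 1, 0] ![0, 1, 0] - prodLin ![1, 0, 0] ![0, 0, 1]) = 0 ∧
    quadDet (prodLin ![1, 0, 0] ![0, 1, 0]) = 0 := by
  refine ⟨?_, ?_, ?_, ?_⟩ <;> simp [quadDet, quadDetMixed, prodLin]
  norm_num

theorem invariants_form₆ :
    quadDet (prodLin ![1, 0, 0] ![0, 1, 1]) = 0 ∧
    quadDetMixed (prodLin ![1, 0, 0] ![0, 1, 1]) (prodLin ![0, 1, 0] ![1, 0, 1]) = 1 / 4 ∧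
    quadDetMixed (prodLin ![0, 1, 0] ![1, 0, 1]) (prodLin ![1, 0, 0] ![0, 1, 1]) = 1 / 4 ∧
    quadDet (prodLin ![0, 1, 0] ![1, 0, 1]) = 0 := by
  refine ⟨?_, ?_, ?_, ?_⟩ <;> simp [quadDet, quadDetMixed, prodLin] <;> norm_num

theorem invariants_form₇ :
    quadDet (prodLin ![1, 0, 0] ![0, 0, 1]) = 0 ∧
    quadDetMixed (prodLin ![1, 0, 0] ![0, 0, 1]) (prodLin ![0, 1, 0] ![-1, 1, 0]) = -1 / 4 ∧
    quadDetMixed (prodLin ![0, 1, 0] ![-1, 1, 0]) (prodLin ![1, 0, 0] ![0, 0, 1]) = 0 ∧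
    quadDet (prodLin ![0, 1, 0] ![-1, 1, 0]) = 0 := by
  refine ⟨?_, ?_, ?_, ?_⟩ <;> simp [quadDet, quadDetMixed, prodLin]
  norm_num

/-- The Hessian of the cube of a linear form vanishes. -/
theorem hess_of_mem_formOrbit₅ {ω : FormSpace 2} (h : ω ∈ formOrbit form₅) (α β : Fin 6) :
    hess (plucker ω α) (plucker ω β) = 0 ∧ hessMid (plucker ω α) (plucker ω β) = 0 := by
  rw [form₅_eq] at h
  obtain ⟨k, -, hk⟩ := exists_cubic_of_mem_formOrbit h
  obtain ⟨s, t, p, q, -, h1, h2, h3, h4⟩ := hk α β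
  obtain ⟨e1, e2, e3, e4⟩ := invariants_form₅
  rw [e1, e2, e3, e4] at h1 h2 h3 h4
  simp only [hess, hessMid, h1, h2, h3, h4]
  constructor <;> ring

theorem disc_of_mem_formOrbit₅ {ω : FormSpace 2} (h : ω ∈ formOrbit form₅) (α β : Fin 6) :
    disc (plucker ω α) (plucker ω β) = 0 := by
  have h1 := disc_eq_hess (plucker ω α) (plucker ω β)
  have h2 := hess_of_mem_formOrbit₅ h α β
  rw [h2.1, h2.2] at h1
  linear_combination h1 / 3

/-- Three distinct roots give a nonzero discriminant. A change of basis multiplies it by the sixth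
power of its determinant, here the entry `α β`. -/
theorem disc_of_mem_formOrbit₆ {ω : FormSpace 2} (h : ω ∈ formOrbit form₆) {α β : Fin 6}
    (hP : plucker ω α β ≠ 0) : disc (plucker ω α) (plucker ω β) ≠ 0 := by
  rw [form₆_eq] at h
  obtain ⟨k, hk0, hk⟩ := exists_cubic_of_mem_formOrbit h
  obtain ⟨s, t, p, q, h0, h1, h2, h3, h4⟩ := hk α β
  obtain ⟨e1, e2, e3, e4⟩ := invariants_form₆
  rw [e1, e2, e3, e4] at h1 h2 h3 h4
  have : disc (plucker ω α) (plucker ω β) = (k / 4) ^ 4 * plucker ω α β ^ 6 := by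
    simp only [disc, h1, h2, h3, h4, ← h0]
    ring
  rw [this]
  exact mul_ne_zero (pow_ne_zero _ (div_ne_zero hk0 (by norm_num))) (pow_ne_zero _ hP)

/-- The Hessian of `s² t` is a multiple of `s²`. Its first coefficient vanishes only if the first
row is the double root, which is singular; both outer coefficients vanish only if the rows are
dependent. -/
theorem hess_of_mem_formOrbit₇ {ω : FormSpace 2} (h : ω ∈ formOrbit form₇) {α β : Fin 6} :
    disc (plucker ω α) (plucker ω β) = 0 ∧ (plucker ω α β ≠ 0 →
      (quadDet (plucker ω α) ≠ 0 → hess (plucker ω α) (plucker ω β) ≠ 0) ∧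
      (hess (plucker ω α) (plucker ω β) ≠ 0 ∨ hess (plucker ω β) (plucker ω α) ≠ 0)) := by
  rw [form₇_eq] at h
  obtain ⟨k, hk0, hk⟩ := exists_cubic_of_mem_formOrbit h
  obtain ⟨s, t, p, q, h0, h1, h2, h3, h4⟩ := hk α β
  obtain ⟨e1, e2, e3, e4⟩ := invariants_form₇
  rw [e1, e2, e3, e4] at h1 h2 h3 h4
  have hs : hess (plucker ω α) (plucker ω β) = (k / 4 * s * plucker ω α β) ^ 2 := by
    simp only [hess, h1, h2, h3, ← h0]
    ring
  have hp : hess (plucker ω β) (plucker ω α) = (k / 4 * p * plucker ω α β) ^ 2 := by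
    simp only [hess, h2, h3, h4, ← h0]
    ring
  refine ⟨?_, fun hP => ⟨fun hD => ?_, ?_⟩⟩
  · simp only [disc, h1, h2, h3, h4]
    ring
  · have hs0 : s ≠ 0 := by
      rintro rfl
      exact hD (by rw [h1]; ring)
    rw [hs]
    exact pow_ne_zero _ (mul_ne_zero (mul_ne_zero (div_ne_zero hk0 (by norm_num)) hs0) hP)
  · rw [hs, hp]
    by_contra! h5
    simp only [ne_eq, OfNat.ofNat_ne_zero, not_false_eq_true, pow_eq_zero_iff, mul_eq_zero,
      div_eq_zero_iff, hk0, hP, or_false, false_or] at h5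
    apply hP
    rw [← h0, h5.1, h5.2]
    ring

/-! ### Decomposable forms -/

/-- The Plücker relations: the `1`-form comes from a pencil of conics. -/
def Decomposable (ω : FormSpace 2) : Prop :=
  ∀ α β γ δ, plucker ω α β * plucker ω γ δ =
    plucker ω α γ * plucker ω β δ - plucker ω α δ * plucker ω β γ

theorem decomposable_pform (u v : Fin 6 → ℂ) : Decomposable (pform u v) := by
  intro α β γ δ
  simp only [plucker_pform]
  ring

theorem exists_plucker_ne_zero {ω : FormSpace 2} (h : ω ≠ 0) : ∃ α β, plucker ω α β ≠ 0 := by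
  by_contra! h0
  exact h (eq_zero_of_plucker_eq_zero (funext fun α => funext fun β => h0 α β))

theorem pform_plucker {ω : FormSpace 2} {α β : Fin 6}
    (h : ∀ γ δ, plucker ω α β * plucker ω γ δ =
      plucker ω α γ * plucker ω β δ - plucker ω α δ * plucker ω β γ) :
    pform (plucker ω α) (plucker ω β) = plucker ω α β • ω := by
  apply plucker_injective
  funext γ δ
  rw [plucker_pform, map_smul]
  exact (h γ δ).symm

theorem eq_pform_plucker {ω : FormSpace 2} {α β : Fin 6} (hP : plucker ω α β ≠ 0)
    (h : ∀ γ δ, plucker ω α β * plucker ω γ δ =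
      plucker ω α γ * plucker ω β δ - plucker ω α δ * plucker ω β γ) :
    ω = pform ((plucker ω α β)⁻¹ • plucker ω α) (plucker ω β) := by
  rw [pform_eq_smul, pform_plucker h, smul_smul, inv_mul_cancel₀ hP, one_smul]

theorem Decomposable.exists_eq_pform {ω : FormSpace 2} (h : Decomposable ω) (h0 : ω ≠ 0) :
    ∃ u v, ω = pform u v := by
  obtain ⟨α, β, hP⟩ := exists_plucker_ne_zero h0
  exact ⟨_, _, eq_pform_plucker hP (h α β)⟩

theorem Decomposable.of_mem_pencilOrbits {ω : FormSpace 2} (h : ω ∈ pencilOrbits) :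
    Decomposable ω := by
  rcases h with (h | h) | h <;> obtain ⟨φ, -, rfl⟩ := exists_of_mem_formOrbit h
  · rw [form₅_eq, ← pform_act]
    exact decomposable_pform _ _
  · rw [form₆_eq, ← pform_act]
    exact decomposable_pform _ _
  · rw [form₇_eq, ← pform_act]
    exact decomposable_pform _ _

/-- The orbits themselves are not closed conditions, but on forms without common factor their union
is cut out by the Plücker relations. -/
theorem mem_pencilOrbits_iff {ω : FormSpace 2} (h : NoCommonFactor ω.1) :
    ω ∈ pencilOrbits ↔ Decomposable ω := by
  refine ⟨Decomposable.of_mem_pencilOrbits, fun hd => ?_⟩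
  obtain ⟨u, v, rfl⟩ := hd.exists_eq_pform h.ne_zero
  exact h.nondegenerate.mem_pencilOrbits

/-! ### The topology of the space of foliations -/

/-- The topology of the norm on the space of `1`-forms. -/
noncomputable abbrev formTopology (N : ℕ) : TopologicalSpace (FormSpace N) :=
  PseudoMetricSpace.toUniformSpace.toTopologicalSpace

/-- The quotient topology on the projective space is built from coefficientwise convergence, whereas
the calculus below uses the norm. This is one half of their comparison. -/
theorem subtypeTopology_le (N : ℕ) :
    (instTopologicalSpaceSubtype : TopologicalSpace (FormSpace N)) ≤ formTopology N := by
  change instTopologicalSpaceSubtype ≤ TopologicalSpace.induced (coeffs N) Pi.topologicalSpace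
  rw [← continuous_iff_le_induced]
  refine continuous_pi fun p => ?_
  have h1 : Continuous fun a : Poly => MvPolynomial.coeff p.2.1 a :=
    (continuous_apply p.2.1).comp continuous_induced_dom
  exact h1.comp ((continuous_apply p.1).comp continuous_subtype_val)

attribute [local instance] formTopology

theorem continuous_formCoeff (N : ℕ) (i : Fin 3) (d : Fin 3 →₀ ℕ) :
    Continuous fun ω : FormSpace N => (ω.1 i).coeff d :=
  (MvPolynomial.lcoeff ℂ d ∘ₗ LinearMap.proj (φ := fun _ : Fin 3 => Poly) i ∘ₗ
    (FormSpace N).subtype : FormSpace N →ₗ[ℂ] ℂ).continuous_of_finiteDimensional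

/-- The topology of the norm is the one induced by coefficientwise convergence of polynomials. -/
theorem formTopology_eq (N : ℕ) : (instTopologicalSpaceSubtype : TopologicalSpace (FormSpace N)) =
    formTopology N := by
  refine le_antisymm (subtypeTopology_le N) (continuous_iff_le_induced.mp ?_)
  exact continuous_pi fun i => continuous_induced_rng.mpr (continuous_pi fun d =>
    continuous_formCoeff N i d)

theorem continuous_mk' : Continuous
    (Projectivization.mk' ℂ : {ω : FormSpace 2 // ω ≠ 0} → Projectivization ℂ (FormSpace 2)) := by
  rw [← formTopology_eq]
  exact continuous_coinduced_rng

theorem isClosed_projectivization_iff (S : Set (Projectivization ℂ (FormSpace 2))) :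
    IsClosed S ↔
      IsClosed ((Projectivization.mk' ℂ : {ω : FormSpace 2 // ω ≠ 0} → _) ⁻¹' S) := by
  rw [← formTopology_eq]
  exact isClosed_coinduced

theorem isClosed_setOf_rep_mem {Z : Set (FormSpace 2)} (hZ : IsClosed Z)
    (hs : ∀ (c : ℂˣ) (ω : FormSpace 2), c • ω ∈ Z ↔ ω ∈ Z) :
    IsClosed {F : Foliation 2 | F.1.rep ∈ Z} := by
  have h1 : IsClosed {p : Projectivization ℂ (FormSpace 2) | p.rep ∈ Z} := by
    rw [isClosed_projectivization_iff]
    convert hZ.preimage (continuous_subtype_val (p := fun ω : FormSpace 2 => ω ≠ 0)) using 1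
    ext ω
    obtain ⟨c, hc⟩ := Projectivization.exists_smul_eq_mk_rep ℂ ω.1 ω.2
    change (Projectivization.mk ℂ ω.1 ω.2).rep ∈ Z ↔ ω.1 ∈ Z
    rw [← hc, hs]
  exact h1.preimage continuous_subtype_val

/-- The ambiguity of the representative is harmless, since `formOrbit` is stable under nonzero
scalars. -/
theorem mem_orbit_ofForm_iff {ω : FormSpace 2} (h : NoCommonFactor ω.1) (F : Foliation 2) :
    F ∈ orbit (Foliation.ofForm ω h) ↔ F.1.rep ∈ formOrbit ω := by
  constructor
  · rintro ⟨g, rfl⟩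
    induction g using Matrix.ProjGenLinGroup.induction_on with | mk g =>
    change (g • (Projectivization.mk ℂ ω h.ne_zero)).rep ∈ _
    rw [Projectivization.smul_mk]
    obtain ⟨c, hc⟩ := Projectivization.exists_smul_eq_mk_rep ℂ (g • ω)
      ((smul_ne_zero_iff_ne g).mpr h.ne_zero)
    rw [← hc, Units.smul_def]
    exact mem_formOrbit_trans (smul_mem_formOrbit c.ne_zero _) ⟨g, rfl⟩
  · rintro ⟨g, hg⟩
    refine ⟨Matrix.ProjGenLinGroup.mk g, ?_⟩
    apply Subtype.ext
    change g • (Projectivization.mk ℂ ω h.ne_zero) = F.1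
    rw [Projectivization.smul_mk, ← F.1.mk_rep]
    congr 1

theorem cone_orbit_ofForm {ω : FormSpace 2} (h : NoCommonFactor ω.1) :
    cone (orbit (Foliation.ofForm ω h)) = formOrbit ω := by
  ext η
  constructor
  · rintro ⟨h0, F, hF, hFη⟩
    rw [mem_orbit_ofForm_iff, hFη] at hF
    obtain ⟨c, hc⟩ := Projectivization.exists_smul_eq_mk_rep ℂ η h0
    rw [← hc, Units.smul_def] at hF
    exact mem_formOrbit_trans (mem_formOrbit_symm (smul_mem_formOrbit c.ne_zero _)) hF
  · rintro ⟨g, rfl⟩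
    refine ⟨(smul_ne_zero_iff_ne g).mpr h.ne_zero, g • Foliation.ofForm ω h,
      ⟨Matrix.ProjGenLinGroup.mk g, rfl⟩, rfl⟩

theorem mem_closure_of_tendsto_form {S : Set (Foliation 2)} {F : Foliation 2} {f : ℂ → FormSpace 2}
    (hf : ContinuousAt f 0) (hF : F.1.rep = f 0)
    (hS : ∀ᶠ t in nhdsWithin (0 : ℂ) {0}ᶜ, f t ∈ cone S) : F ∈ closure S := by
  have h0 : f 0 ≠ 0 := hF ▸ F.1.rep_nonzero
  refine closure_subtype.mpr ?_
  classical
  let g : ℂ → {ω : FormSpace 2 // ω ≠ 0} := fun t => if h : f t ≠ 0 then ⟨f t, h⟩ else ⟨f 0, h0⟩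
  have hg : ∀ᶠ t in nhds 0, (g t).1 = f t := by
    filter_upwards [hf.eventually_ne h0] with t ht
    simp [g, ht]
  have hgc : ContinuousAt g 0 := by
    refine Topology.IsInducing.subtypeVal.continuousAt_iff.mpr ?_
    exact hf.congr (hg.mono fun t ht => ht.symm)
  have h1 : Filter.Tendsto (fun t => Projectivization.mk' ℂ (g t)) (nhdsWithin 0 {0}ᶜ)
      (nhds F.1) := by
    have h2 : Projectivization.mk' ℂ (g 0) = F.1 := by
      rw [← F.1.mk_rep, Projectivization.mk'_eq_mk]
      congr 1
      rw [hF, hg.self_of_nhds]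
    rw [← h2]
    exact ((continuous_mk'.continuousAt).comp hgc).tendsto.mono_left nhdsWithin_le_nhds
  refine mem_closure_of_tendsto h1 ?_
  filter_upwards [hS, hg.filter_mono nhdsWithin_le_nhds] with t ht htg
  obtain ⟨hne, G, hG, hGt⟩ := ht
  refine ⟨G, hG, ?_⟩
  rw [hGt, Projectivization.mk'_eq_mk]
  congr 1
  exact htg.symm

theorem continuous_plucker (α β : Fin 6) : Continuous fun ω : FormSpace 2 => plucker ω α β :=
  ((LinearMap.proj β ∘ₗ LinearMap.proj α ∘ₗ plucker :
    FormSpace 2 →ₗ[ℂ] ℂ)).continuous_of_finiteDimensional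

/-! ### Submanifolds as zero sets of submersions -/

/-- If, near `p`, the set `S` is the zero set of a map `f` which has a differentiable local right
inverse `γ` through `p`, then `S` has a holomorphic chart at `p`. -/
theorem exists_submanifold_chart {E F : Type*} [NormedAddCommGroup E] [NormedSpace ℂ E]
    [FiniteDimensional ℂ E] [NormedAddCommGroup F] [NormedSpace ℂ F] [FiniteDimensional ℂ F]
    {S : Set E} {p : E} {f : E → F} {γ : F → E} {k : ℕ} (hf : ContDiff ℂ 1 f)
    (hγ : DifferentiableAt ℂ γ 0) (hγp : γ 0 = p) (hfγ : ∀ y, f (γ y) = y)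
    (hS : ∀ᶠ x in nhds p, x ∈ S ↔ f x = 0)
    (hk : Module.finrank ℂ E = k + Module.finrank ℂ F) :
    ∃ (φ : OpenPartialHomeomorph E E) (W : Submodule ℂ E),
      p ∈ φ.source ∧ DifferentiableOn ℂ φ φ.source ∧ DifferentiableOn ℂ φ.symm φ.target ∧
      Module.finrank ℂ W = k ∧ ∀ x ∈ φ.source, x ∈ S ↔ φ x ∈ W := by
  have : CompleteSpace E := FiniteDimensional.complete ℂ E
  set A : E →L[ℂ] F := fderiv ℂ f p with hA
  set σ : F →L[ℂ] E := fderiv ℂ γ 0 with hσ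
  have hfA : HasFDerivAt f A p := (hf.differentiable one_ne_zero).differentiableAt.hasFDerivAt
  have hAσ (y : F) : A (σ y) = y := by
    have h1 : HasFDerivAt (f ∘ γ) (A.comp σ) 0 :=
      HasFDerivAt.comp 0 (hγp ▸ hfA) hγ.hasFDerivAt
    have h2 : f ∘ γ = id := funext hfγ
    rw [h2] at h1
    have h3 := h1.unique (hasFDerivAt_id 0)
    exact DFunLike.congr_fun h3 y
  -- As `A ∘ σ = id`, this map satisfies `A (G x) = f x` and has derivative the identity at `p`. It
  -- straightens the zero set of `f` to the kernel of `A`.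
  let G : E → E := fun x => x - σ (A x) + σ (f x)
  have hG : ContDiff ℂ 1 G :=
    (contDiff_id.sub (σ.contDiff.comp A.contDiff)).add (σ.contDiff.comp hf)
  have hG' : HasFDerivAt G ((ContinuousLinearEquiv.refl ℂ E : E ≃L[ℂ] E) : E →L[ℂ] E) p := by
    have h1 : HasFDerivAt G (ContinuousLinearMap.id ℂ E - σ.comp A + σ.comp A) p :=
      ((hasFDerivAt_id p).sub (σ.comp A).hasFDerivAt).add (σ.hasFDerivAt.comp p hfA)
    simpa using h1
  have hGp : ContDiffAt ℂ 1 G p := hG.contDiffAt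
  let ψ := hGp.toOpenPartialHomeomorph G hG' one_ne_zero
  have hψ : ∀ x, ψ x = G x := fun x => rfl
  have hp : p ∈ ψ.source := hGp.mem_toOpenPartialHomeomorph_source hG' one_ne_zero
  have hsymm : ContDiffAt ℂ 1 ψ.symm (G p) := hGp.to_localInverse hG' one_ne_zero
  have hd : ∀ᶠ y in nhds (G p), DifferentiableAt ℂ ψ.symm y :=
    (hsymm.eventually (by simp)).mono fun y hy => hy.differentiableAt one_ne_zero
  have hall : ∀ᶠ x in nhds p, DifferentiableAt ℂ ψ.symm (G x) ∧ (x ∈ S ↔ f x = 0) :=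
    (hG.continuous.continuousAt.eventually hd).and hS
  obtain ⟨U, hU, hUo, hpU⟩ := eventually_nhds_iff.mp hall
  refine ⟨ψ.restrOpen U hUo, LinearMap.ker A.toLinearMap, ⟨hp, hpU⟩, ?_, ?_, ?_, ?_⟩
  · exact (hG.differentiable one_ne_zero).differentiableOn
  · intro y hy
    have h1 : y ∈ ψ.target := hy.1
    have h2 : ψ.symm y ∈ U := hy.2
    have h3 := (hU _ h2).1
    rw [← hψ, ψ.right_inv h1] at h3
    exact h3.differentiableWithinAt
  · have h1 := LinearMap.finrank_range_add_finrank_ker A.toLinearMap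
    have h2 : LinearMap.range A.toLinearMap = ⊤ := LinearMap.range_eq_top.mpr fun y => ⟨σ y, hAσ y⟩
    rw [h2, finrank_top] at h1
    omega
  · intro x hx
    rw [(hU x hx.2).2, LinearMap.mem_ker]
    have h1 : A (G x) = f x := by
      simp only [G, map_add, map_sub, hAσ]
      abel
    change f x = 0 ↔ A (G x) = 0
    rw [h1]

/-! ### Nondegeneracy of nearby pencils -/

/-- The adjugate of the symmetric matrix of a quadratic form. -/
def quadAdj (u : Fin 6 → ℂ) : Fin 6 → ℂ :=
  ![u 1 * u 2 - u 5 ^ 2, u 0 * u 2 - u 4 ^ 2, u 0 * u 1 - u 3 ^ 2, u 4 * u 5 - u 2 * u 3,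
    u 3 * u 5 - u 1 * u 4, u 3 * u 4 - u 0 * u 5]

theorem quadAdj_smul (c : ℂ) (u : Fin 6 → ℂ) : quadAdj (c • u) = c ^ 2 • quadAdj u := by
  funext α
  fin_cases α <;> simp [quadAdj] <;> ring

theorem quadAdj_prodLin (l : Fin 3 → ℂ) : quadAdj (prodLin l l) = 0 := by
  funext α
  fin_cases α <;> simp [quadAdj, prodLin] <;> ring

theorem quadDet_prodLin (l m : Fin 3 → ℂ) : quadDet (prodLin l m) = 0 := by
  simp [quadDet, prodLin]
  ring

theorem quadDetMixed_prodLin (l m n : Fin 3 → ℂ) :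
    quadDetMixed (prodLin l m) (prodLin l n) = 0 := by
  simp [quadDetMixed, prodLin]
  ring

/-- The adjugate vanishes on double lines, and every member of a pencil with a fixed line is
singular. -/
theorem nondegenerate_of_rows {ω : FormSpace 2} {α β : Fin 6} (hP : plucker ω α β ≠ 0)
    (hadj : ∀ s t : ℂ, quadAdj (s • plucker ω α + t • plucker ω β) = 0 → s = 0 ∧ t = 0)
    {s₀ t₀ : ℂ} (hdet : quadDet (s₀ • plucker ω α + t₀ • plucker ω β) ≠ 0) :
    Nondegenerate ω := by
  constructor
  · rintro l v rfl
    set u := prodLin l l with hu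
    -- This recovers the member `u` of the pencil from the two rows, up to the nonzero factor
    -- `plucker ω α β`.
    have h1 : u β • plucker (pform u v) α + (-u α) • plucker (pform u v) β =
        plucker (pform u v) α β • u := by
      simp only [plucker_row, plucker_pform]
      module
    have h2 := hadj (u β) (-u α) (by rw [h1, quadAdj_smul, hu, quadAdj_prodLin, smul_zero])
    apply hP
    rw [plucker_pform, h2.1, neg_eq_zero.mp h2.2]
    ring
  · rintro l m n rfl
    apply hdet
    simp only [plucker_row, quadDet_comb, quadDetMixed_comb, quadDet_prodLin, quadDetMixed_prodLin]
    ring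

theorem continuous_plucker_row (α : Fin 6) : Continuous fun ω : FormSpace 2 => plucker ω α :=
  continuous_pi fun β => continuous_plucker α β

theorem continuous_quadAdj : Continuous quadAdj := by
  refine continuous_pi fun α => ?_
  fin_cases α <;> simp only [quadAdj] <;> simp <;> fun_prop

theorem continuous_quadDet : Continuous quadDet := by
  unfold quadDet
  fun_prop

theorem eventually_quadAdj {ω₀ : FormSpace 2} {α β : Fin 6}
    (hadj : ∀ s t : ℂ, quadAdj (s • plucker ω₀ α + t • plucker ω₀ β) = 0 → s = 0 ∧ t = 0) :
    ∀ᶠ ω in nhds ω₀, ∀ s t : ℂ,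
      quadAdj (s • plucker ω α + t • plucker ω β) = 0 → s = 0 ∧ t = 0 := by
  have hcont : Continuous fun z : FormSpace 2 × (ℂ × ℂ) =>
      quadAdj (z.2.1 • plucker z.1 α + z.2.2 • plucker z.1 β) := by
    have h1 := (continuous_plucker_row α).comp (continuous_fst (X := FormSpace 2) (Y := ℂ × ℂ))
    have h2 := (continuous_plucker_row β).comp (continuous_fst (X := FormSpace 2) (Y := ℂ × ℂ))
    exact continuous_quadAdj.comp
      (((continuous_fst.comp continuous_snd).smul h1).add
        ((continuous_snd.comp continuous_snd).smul h2))
  -- The adjugate is homogeneous in `(s, t)`, so nonvanishing need only be checked on the unit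
  -- sphere, where compactness makes it an open condition on `ω`.
  have h := (isCompact_sphere (0 : ℂ × ℂ) 1).eventually_forall_of_forall_eventually (x₀ := ω₀)
    (P := fun ω z => quadAdj (z.1 • plucker ω α + z.2 • plucker ω β) ≠ 0) (by
      intro z hz
      refine hcont.continuousAt.eventually_ne fun h0 => ?_
      obtain ⟨h1, h2⟩ := hadj _ _ h0
      have : z = 0 := Prod.ext h1 h2
      simp [this] at hz)
  filter_upwards [h] with ω hω s t hst
  by_contra hne
  have hz : ((s, t) : ℂ × ℂ) ≠ 0 := fun h0 => hne (by simpa using h0)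
  set r : ℂ := (‖((s, t) : ℂ × ℂ)‖ : ℂ)⁻¹ with hr
  refine hω (r • (s, t)) ?_ ?_
  · rw [mem_sphere_zero_iff_norm, norm_smul, hr, norm_inv, Complex.norm_real, norm_norm,
      inv_mul_cancel₀ (norm_ne_zero_iff.mpr hz)]
  · have : (r • (s, t)).1 • plucker ω α + (r • (s, t)).2 • plucker ω β =
        r • (s • plucker ω α + t • plucker ω β) := by
      simp only [Prod.smul_mk, smul_eq_mul, smul_add, smul_smul]
    rw [this, quadAdj_smul, hst, smul_zero]

/-- Near a nondegenerate pencil, every pencil of conics is nondegenerate. -/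
theorem eventually_mem_pencilOrbits {ω₀ : FormSpace 2} {α β : Fin 6} (hP : plucker ω₀ α β ≠ 0)
    (hadj : ∀ s t : ℂ, quadAdj (s • plucker ω₀ α + t • plucker ω₀ β) = 0 → s = 0 ∧ t = 0)
    {s₀ t₀ : ℂ} (hdet : quadDet (s₀ • plucker ω₀ α + t₀ • plucker ω₀ β) ≠ 0) :
    ∀ᶠ ω in nhds ω₀, plucker ω α β ≠ 0 ∧ ((∀ γ δ, plucker ω α β * plucker ω γ δ =
      plucker ω α γ * plucker ω β δ - plucker ω α δ * plucker ω β γ) → ω ∈ pencilOrbits) := by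
  have h1 := (continuous_plucker α β).continuousAt.eventually_ne hP
  have h2 : Continuous fun ω : FormSpace 2 => quadDet (s₀ • plucker ω α + t₀ • plucker ω β) :=
    continuous_quadDet.comp (((continuous_plucker_row α).const_smul s₀).add
      ((continuous_plucker_row β).const_smul t₀))
  filter_upwards [h1, eventually_quadAdj hadj, h2.continuousAt.eventually_ne hdet] with ω hω1 hω2 hω3
  refine ⟨hω1, fun hrel => ?_⟩
  have hnd := nondegenerate_of_rows hω1 hω2 hω3
  rw [eq_pform_plucker hω1 hrel] at hnd ⊢
  exact hnd.mem_pencilOrbits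

/-! ### Orbits as submanifolds -/

/-- The pairs of indices which do not involve `α` and `β`. -/
abbrev ComplPair (α β : Fin 6) : Type :=
  {p : Fin 6 × Fin 6 // p.1 < p.2 ∧ p.1 ≠ α ∧ p.1 ≠ β ∧ p.2 ≠ α ∧ p.2 ≠ β}

theorem card_complPair {α β : Fin 6} (h : α ≠ β) : Fintype.card (ComplPair α β) = 6 := by
  revert α β
  decide

/-- The Plücker relations which involve the pair `α`, `β`. -/
noncomputable def pluckerRel (α β : Fin 6) (ω : FormSpace 2) : ComplPair α β → ℂ := fun p =>
  plucker ω α β * plucker ω p.1.1 p.1.2 -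
    (plucker ω α p.1.1 * plucker ω β p.1.2 - plucker ω α p.1.2 * plucker ω β p.1.1)

theorem plucker_self (ω : FormSpace 2) (α : Fin 6) : plucker ω α α = 0 := by
  rw [plucker_apply, sub_self]

/-- The relations in which `γ` or `δ` equals `α` or `β` are identities by antisymmetry; the six
others remain. -/
theorem pluckerRel_eq_zero_iff {α β : Fin 6} {ω : FormSpace 2} :
    pluckerRel α β ω = 0 ↔ ∀ γ δ, plucker ω α β * plucker ω γ δ =
      plucker ω α γ * plucker ω β δ - plucker ω α δ * plucker ω β γ := by
  constructor
  · intro h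
    have key : ∀ γ δ, γ < δ → plucker ω α β * plucker ω γ δ =
        plucker ω α γ * plucker ω β δ - plucker ω α δ * plucker ω β γ := by
      intro γ δ hlt
      by_cases h1 : γ = α
      · subst h1
        rw [plucker_self, plucker_antisymm ω β γ]
        ring
      by_cases h2 : γ = β
      · subst h2
        rw [plucker_self]
        ring
      by_cases h3 : δ = α
      · subst h3
        rw [plucker_self, plucker_antisymm ω β δ, plucker_antisymm ω γ δ]
        ring
      by_cases h4 : δ = β
      · subst h4
        rw [plucker_self, plucker_antisymm ω γ δ]
        ring
      exact sub_eq_zero.mp (congrFun h ⟨(γ, δ), hlt, h1, h2, h3, h4⟩)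
    intro γ δ
    rcases lt_trichotomy γ δ with hlt | rfl | hlt
    · exact key γ δ hlt
    · rw [plucker_self]
      ring
    · have := key δ γ hlt
      rw [plucker_antisymm ω γ δ]
      linear_combination -this
  · intro h
    funext p
    exact sub_eq_zero.mpr (h p.1.1 p.1.2)

theorem contDiff_plucker (α β : Fin 6) : ContDiff ℂ 1 fun ω : FormSpace 2 => plucker ω α β :=
  (LinearMap.toContinuousLinearMap (LinearMap.proj β ∘ₗ LinearMap.proj α ∘ₗ plucker :
    FormSpace 2 →ₗ[ℂ] ℂ)).contDiff

theorem contDiff_plucker_row (α : Fin 6) : ContDiff ℂ 1 fun ω : FormSpace 2 => plucker ω α :=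
  contDiff_pi.mpr fun β => contDiff_plucker α β

theorem contDiff_pluckerRel (α β : Fin 6) : ContDiff ℂ 1 (pluckerRel α β) :=
  contDiff_pi.mpr fun _ => ((contDiff_plucker α β).mul (contDiff_plucker _ _)).sub
    (((contDiff_plucker _ _).mul (contDiff_plucker _ _)).sub
      ((contDiff_plucker _ _).mul (contDiff_plucker _ _)))

/-- A linear map applied to polynomials in the entries of `u` and `v`; this form makes
differentiability immediate. -/
theorem pform_eq_symm (u v : Fin 6 → ℂ) :
    pform u v = LinearMap.toContinuousLinearMap pluckerEquiv.symm.toLinearMap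
      fun p : Pair => u p.1.1 * v p.1.2 - u p.1.2 * v p.1.1 := by
  change _ = pluckerEquiv.symm _
  rw [LinearEquiv.eq_symm_apply]
  funext p
  rw [pluckerEquiv_apply, plucker_pform]

theorem differentiable_pform {Y : Type*} [NormedAddCommGroup Y] [NormedSpace ℂ Y]
    {u v : Y → Fin 6 → ℂ} (hu : Differentiable ℂ u) (hv : Differentiable ℂ v) :
    Differentiable ℂ fun y => pform (u y) (v y) := by
  simp only [pform_eq_symm]
  refine (ContinuousLinearMap.differentiable _).comp (differentiable_pi.mpr fun p => ?_)
  rw [differentiable_pi] at hu hv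
  exact ((hu _).mul (hv _)).sub ((hu _).mul (hv _))

/-- The perturbation of a family of pencils which prescribes the values of `pluckerRel`. -/
noncomputable def perturb {Y : Type*} (α β : Fin 6) (c : ℂ) (u v : Y → Fin 6 → ℂ)
    (z : (ComplPair α β → ℂ) × Y) : FormSpace 2 :=
  pform (u z.2) (v z.2) +
    ∑ p, (c⁻¹ * z.1 p) • pform (Pi.single p.1.1 1) (Pi.single p.1.2 1)

theorem plucker_perturb {Y : Type*} (α β : Fin 6) (c : ℂ) (u v : Y → Fin 6 → ℂ)
    (z : (ComplPair α β → ℂ) × Y) (γ δ : Fin 6) :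
    plucker (perturb α β c u v z) γ δ = u z.2 γ * v z.2 δ - u z.2 δ * v z.2 γ +
      ∑ p : ComplPair α β, c⁻¹ * z.1 p *
        plucker (pform (Pi.single p.1.1 1) (Pi.single p.1.2 1)) γ δ := by
  simp [perturb, plucker_pform]

/-- The added bivectors involve neither index `α` nor `β`. Rows `α` and `β`, hence all invariants
computed from them, are not affected. -/
theorem plucker_perturb_left {Y : Type*} (α β : Fin 6) (c : ℂ) (u v : Y → Fin 6 → ℂ)
    (z : (ComplPair α β → ℂ) × Y) :
    plucker (perturb α β c u v z) α = (-v z.2 α) • u z.2 + u z.2 α • v z.2 := by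
  funext δ
  rw [plucker_perturb, Finset.sum_eq_zero]
  · simp only [Pi.add_apply, Pi.smul_apply, smul_eq_mul]
    ring
  · intro p _
    rw [plucker_pform, Pi.single_eq_of_ne p.2.2.1.symm, Pi.single_eq_of_ne p.2.2.2.2.1.symm]
    ring

theorem plucker_perturb_right {Y : Type*} (α β : Fin 6) (c : ℂ) (u v : Y → Fin 6 → ℂ)
    (z : (ComplPair α β → ℂ) × Y) :
    plucker (perturb α β c u v z) β = (-v z.2 β) • u z.2 + u z.2 β • v z.2 := by
  funext δ
  rw [plucker_perturb, Finset.sum_eq_zero]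
  · simp only [Pi.add_apply, Pi.smul_apply, smul_eq_mul]
    ring
  · intro p _
    rw [plucker_pform, Pi.single_eq_of_ne p.2.2.2.1.symm, Pi.single_eq_of_ne p.2.2.2.2.2.symm]
    ring

theorem pluckerRel_perturb {Y : Type*} {α β : Fin 6} {c : ℂ} (hc : c ≠ 0) {u v : Y → Fin 6 → ℂ}
    (z : (ComplPair α β → ℂ) × Y) (h : u z.2 α * v z.2 β - u z.2 β * v z.2 α = c) :
    pluckerRel α β (perturb α β c u v z) = z.1 := by
  funext q
  have h1 : plucker (perturb α β c u v z) α β = c := by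
    rw [plucker_perturb_left, ← h]
    simp only [Pi.add_apply, Pi.smul_apply, smul_eq_mul]
    ring
  have h2 : plucker (perturb α β c u v z) q.1.1 q.1.2 =
      u z.2 q.1.1 * v z.2 q.1.2 - u z.2 q.1.2 * v z.2 q.1.1 + c⁻¹ * z.1 q := by
    rw [plucker_perturb, Finset.sum_eq_single q]
    · rw [plucker_pform_single ⟨q.1, q.2.1⟩ _ _ q.2.1]
      simp
    · intro p _ hp
      rw [plucker_pform_single ⟨p.1, p.2.1⟩ _ _ q.2.1, if_neg fun h => hp (Subtype.ext h), mul_zero]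
    · simp
  rw [pluckerRel, h1, h2, plucker_perturb_left, plucker_perturb_right]
  simp only [Pi.add_apply, Pi.smul_apply, smul_eq_mul]
  rw [mul_add, mul_inv_cancel_left₀ hc, ← h]
  ring

/-- A criterion for an orbit of pencils of conics to be a submanifold: near one of its points it is
defined in the set of pencils by `n` equations, and there is a deformation of this point on which
the left sides of the equations are the coordinates. -/
theorem isComplexSubmanifold_formOrbit {n : ℕ} {η : FormSpace 2} (hη : η ∈ pencilOrbits)
    {α β : Fin 6} (hαβ : α ≠ β) {c : ℂ} (hc : c ≠ 0) {u v : (Fin n → ℂ) → Fin 6 → ℂ}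
    (hu : Differentiable ℂ u) (hv : Differentiable ℂ v)
    (huv : ∀ y, u y α * v y β - u y β * v y α = c) (h0 : pform (u 0) (v 0) = η)
    {h : (Fin 6 → ℂ) → (Fin 6 → ℂ) → Fin n → ℂ}
    (hh : ContDiff ℂ 1 fun z : (Fin 6 → ℂ) × (Fin 6 → ℂ) => h z.1 z.2)
    (hy : ∀ y, h ((-v y α) • u y + u y α • v y) ((-v y β) • u y + u y β • v y) = y)
    (hS : ∀ᶠ ω in nhds η, (∀ γ δ, plucker ω α β * plucker ω γ δ =
      plucker ω α γ * plucker ω β δ - plucker ω α δ * plucker ω β γ) →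
        (ω ∈ formOrbit η ↔ h (plucker ω α) (plucker ω β) = 0))
    {k : ℕ} (hk : k + n = 9) : IsComplexSubmanifold (formOrbit η) k := by
  rintro q ⟨g, rfl⟩
  let f : FormSpace 2 → (ComplPair α β → ℂ) × (Fin n → ℂ) := fun ω =>
    (pluckerRel α β ω, h (plucker ω α) (plucker ω β))
  have hf : ContDiff ℂ 1 f := (contDiff_pluckerRel α β).prodMk
    (hh.comp ((contDiff_plucker_row α).prodMk (contDiff_plucker_row β)))
  let L (g : GL (Fin 3) ℂ) : FormSpace 2 →L[ℂ] FormSpace 2 :=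
    LinearMap.toContinuousLinearMap (pullback (g⁻¹ : GL (Fin 3) ℂ).1)
  have hL (g : GL (Fin 3) ℂ) (ω : FormSpace 2) : L g ω = g • ω := rfl
  have hγ : Differentiable ℂ (perturb α β c u v) := by
    refine ((differentiable_pform hu hv).comp differentiable_snd).add ?_
    refine Differentiable.fun_sum fun p _ => Differentiable.smul_const ?_ _
    exact (differentiable_pi.mp differentiable_fst p).const_mul _
  have hrel : ∀ ω ∈ formOrbit η, ∀ γ δ, plucker ω α β * plucker ω γ δ =
      plucker ω α γ * plucker ω β δ - plucker ω α δ * plucker ω β γ := fun ω hω =>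
    Decomposable.of_mem_pencilOrbits (mem_pencilOrbits_of_mem_formOrbit hω hη) α β
  -- The equations and the right inverse at `η` are transported to the point `g • η` of the orbit.
  refine exists_submanifold_chart (f := f ∘ L g⁻¹) (γ := L g ∘ perturb α β c u v)
    (hf.comp (L g⁻¹).contDiff) ?_ ?_ ?_ ?_ ?_
  · exact (L g).differentiableAt.comp 0 (hγ 0)
  · simp [perturb, h0, hL]
  · intro z
    simp only [Function.comp_apply, hL, inv_smul_smul, f]
    rw [pluckerRel_perturb hc z (huv z.2), plucker_perturb_left, plucker_perturb_right, hy]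
  · have h1 : Filter.Tendsto (L g⁻¹) (nhds (g • η)) (nhds η) := by
      have := (L g⁻¹).continuous.tendsto (g • η)
      rwa [hL, inv_smul_smul] at this
    filter_upwards [h1.eventually hS] with ω hω
    have h2 : ω ∈ formOrbit η ↔ L g⁻¹ ω ∈ formOrbit η := by
      rw [hL]
      exact ⟨fun h => mem_formOrbit_trans ⟨g⁻¹, rfl⟩ h,
        fun h => mem_formOrbit_trans (mem_formOrbit_symm ⟨g⁻¹, rfl⟩) h⟩
    rw [h2]
    simp only [Function.comp_apply, f, Prod.mk_eq_zero, pluckerRel_eq_zero_iff]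
    exact ⟨fun h => ⟨hrel _ h, (hω (hrel _ h)).mp h⟩, fun h => (hω h.1).mpr h.2⟩
  · rw [finrank_formSpace, Module.finrank_prod, Module.finrank_fintype_fun_eq_card,
      Module.finrank_fintype_fun_eq_card, card_complPair hαβ, Fintype.card_fin]
    omega

/-! ### Smoothness of the invariants -/

theorem contDiff_quadDet : ContDiff ℂ 1 quadDet := by
  unfold quadDet
  fun_prop

theorem contDiff_quadDetMixed :
    ContDiff ℂ 1 fun z : (Fin 6 → ℂ) × (Fin 6 → ℂ) => quadDetMixed z.1 z.2 := by
  unfold quadDetMixed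
  fun_prop

theorem contDiff_quadDetMixed_swap :
    ContDiff ℂ 1 fun z : (Fin 6 → ℂ) × (Fin 6 → ℂ) => quadDetMixed z.2 z.1 := by
  unfold quadDetMixed
  fun_prop

theorem contDiff_disc : ContDiff ℂ 1 fun z : (Fin 6 → ℂ) × (Fin 6 → ℂ) => disc z.1 z.2 := by
  have h1 := contDiff_quadDetMixed
  have h2 := contDiff_quadDetMixed_swap
  have h3 := contDiff_quadDet.comp (contDiff_fst (𝕜 := ℂ) (E := Fin 6 → ℂ) (F := Fin 6 → ℂ))
  have h4 := contDiff_quadDet.comp (contDiff_snd (𝕜 := ℂ) (E := Fin 6 → ℂ) (F := Fin 6 → ℂ))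
  simp only [Function.comp_def] at h3 h4
  unfold disc
  fun_prop

theorem contDiff_hess_swap :
    ContDiff ℂ 1 fun z : (Fin 6 → ℂ) × (Fin 6 → ℂ) => hess z.2 z.1 := by
  have h1 := contDiff_quadDetMixed
  have h2 := contDiff_quadDetMixed_swap
  have h4 := contDiff_quadDet.comp (contDiff_snd (𝕜 := ℂ) (E := Fin 6 → ℂ) (F := Fin 6 → ℂ))
  simp only [Function.comp_def] at h4
  unfold hess
  fun_prop

theorem contDiff_hessMid_swap :
    ContDiff ℂ 1 fun z : (Fin 6 → ℂ) × (Fin 6 → ℂ) => hessMid z.2 z.1 := by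
  have h1 := contDiff_quadDetMixed
  have h2 := contDiff_quadDetMixed_swap
  have h3 := contDiff_quadDet.comp (contDiff_fst (𝕜 := ℂ) (E := Fin 6 → ℂ) (F := Fin 6 → ℂ))
  have h4 := contDiff_quadDet.comp (contDiff_snd (𝕜 := ℂ) (E := Fin 6 → ℂ) (F := Fin 6 → ℂ))
  simp only [Function.comp_def] at h3 h4
  unfold hessMid
  fun_prop

theorem continuous_rows {f : (Fin 6 → ℂ) × (Fin 6 → ℂ) → ℂ} (hf : ContDiff ℂ 1 f) (α β : Fin 6) :
    Continuous fun ω : FormSpace 2 => f (plucker ω α, plucker ω β) :=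
  hf.continuous.comp ((continuous_plucker_row α).prodMk (continuous_plucker_row β))

/-! ### The neighbourhoods of the models -/

theorem rows_form₅ : plucker form₅ 1 = ![0, 0, 0, 1 / 2, 0, 0] ∧
    plucker form₅ 3 = ![0, -1 / 2, 0, 0, 1 / 4, 0] := by
  rw [form₅_eq]
  constructor <;> funext β <;> rw [plucker_pform] <;> fin_cases β <;> simp [prodLin] <;> norm_num

theorem rows_form₆ : plucker form₆ 4 = ![0, 0, 0, 1 / 4, 0, 1 / 4] ∧
    plucker form₆ 5 = ![0, 0, 0, -1 / 4, -1 / 4, 0] := by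
  rw [form₆_eq]
  constructor <;> funext β <;> rw [plucker_pform] <;> fin_cases β <;> simp [prodLin] <;> norm_num

theorem rows_form₇ : plucker form₇ 4 = ![0, 1 / 2, 0, -1 / 4, 0, 0] ∧
    plucker form₇ 1 = ![0, 0, 0, 0, -1 / 2, 0] := by
  rw [form₇_eq]
  constructor <;> funext β <;> rw [plucker_pform] <;> fin_cases β <;> simp [prodLin] <;> norm_num

theorem eventually_near_form₅ : ∀ᶠ ω in nhds form₅, plucker ω 1 3 ≠ 0 ∧
    ((∀ γ δ, plucker ω 1 3 * plucker ω γ δ =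
      plucker ω 1 γ * plucker ω 3 δ - plucker ω 1 δ * plucker ω 3 γ) → ω ∈ pencilOrbits) := by
  refine eventually_mem_pencilOrbits (s₀ := 0) (t₀ := 1) ?_ ?_ ?_
  · rw [rows_form₅.1]
    simp
  · intro s t h
    rw [rows_form₅.1, rows_form₅.2] at h
    have h1 := congrFun h 2
    have h2 := congrFun h 1
    simp [quadAdj] at h1 h2
    exact ⟨h1, h2⟩
  · rw [rows_form₅.2]
    simp [quadDet]

theorem eventually_near_form₆ : ∀ᶠ ω in nhds form₆, plucker ω 4 5 ≠ 0 ∧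
    ((∀ γ δ, plucker ω 4 5 * plucker ω γ δ =
      plucker ω 4 γ * plucker ω 5 δ - plucker ω 4 δ * plucker ω 5 γ) → ω ∈ pencilOrbits) := by
  -- Rows 4 and 5 and their sum are the singular members; the weights 2 and 1 avoid all three.
  refine eventually_mem_pencilOrbits (s₀ := 2) (t₀ := 1) ?_ ?_ ?_
  · rw [rows_form₆.1]
    simp
  · intro s t h
    rw [rows_form₆.1, rows_form₆.2] at h
    have h1 := congrFun h 0
    have h2 := congrFun h 1
    simp [quadAdj] at h1 h2
    exact ⟨h1, h2⟩
  · rw [rows_form₆.1, rows_form₆.2]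
    simp [quadDet]
    norm_num

theorem eventually_near_form₇ : ∀ᶠ ω in nhds form₇, plucker ω 4 1 ≠ 0 ∧
    ((∀ γ δ, plucker ω 4 1 * plucker ω γ δ =
      plucker ω 4 γ * plucker ω 1 δ - plucker ω 4 δ * plucker ω 1 γ) → ω ∈ pencilOrbits) := by
  refine eventually_mem_pencilOrbits (s₀ := 1) (t₀ := 1) ?_ ?_ ?_
  · rw [rows_form₇.1]
    simp
  · intro s t h
    rw [rows_form₇.1, rows_form₇.2] at h
    have h1 := congrFun h 2
    have h2 := congrFun h 1
    simp [quadAdj] at h1 h2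
    exact ⟨h1, h2⟩
  · rw [rows_form₇.1, rows_form₇.2]
    simp [quadDet]

theorem plucker_ne_zero_symm {ω : FormSpace 2} {α β : Fin 6} (h : plucker ω α β ≠ 0) :
    plucker ω β α ≠ 0 := by
  rw [plucker_antisymm]
  exact neg_ne_zero.mpr h

/-- The pencil of `Y² - XZ` and `XY + 2 y₀ YZ + y₁ Z²` has the cubic `-λ³/4 - (y₀/2) λμ² - (y₁/4)
μ³`, the unfolding of a triple root. On rows 3 and 1, the constants turn two Hessian coefficients
into `y₀` and `y₁`. -/
theorem isComplexSubmanifold_formOrbit₅ : IsComplexSubmanifold (formOrbit form₅) 7 := by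
  refine isComplexSubmanifold_formOrbit (n := 2) (α := 1) (β := 3) (c := 1 / 2)
    (u := fun _ => ![0, 1, 0, 0, -1 / 2, 0]) (v := fun y => ![0, 0, y 1, 1 / 2, 0, y 0])
    (h := fun x y => ![-128 / 3 * hess y x, 128 / 9 * hessMid y x])
    (Or.inl (Or.inl (MulAction.mem_orbit_self _))) (by decide) (by norm_num) ?_ ?_ ?_ ?_ ?_ ?_ ?_ rfl
  · exact differentiable_const _
  · refine differentiable_pi.mpr fun α => ?_
    fin_cases α <;> simp <;> fun_prop
  · intro y
    simp
  · rw [form₅_eq]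
    congr 1 <;> funext α <;> fin_cases α <;> simp [prodLin]
    norm_num
  · refine contDiff_pi.mpr fun i => ?_
    fin_cases i
    · exact contDiff_const.mul contDiff_hess_swap
    · exact contDiff_const.mul contDiff_hessMid_swap
  · intro y
    funext i
    fin_cases i <;> simp [hess, hessMid, quadDet, quadDetMixed] <;> ring
  -- Only two Hessian coefficients are available. Nonsingularity of row 3 ensures that the first one
  -- already excludes a double root that is not triple.
  · have h1 : ∀ᶠ ω in nhds form₅, quadDet (plucker ω 3) ≠ 0 := by
      refine (continuous_quadDet.comp (continuous_plucker_row 3)).continuousAt.eventually_ne ?_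
      rw [Function.comp_apply, rows_form₅.2]
      simp [quadDet]
    filter_upwards [eventually_near_form₅, h1] with ω hω hdet hrel
    constructor
    · intro h
      obtain ⟨h2, h3⟩ := hess_of_mem_formOrbit₅ h 3 1
      simp [h2, h3]
    · intro h
      have h2 : hess (plucker ω 3) (plucker ω 1) = 0 := by
        simpa using congrFun h 0
      have h3 : hessMid (plucker ω 3) (plucker ω 1) = 0 := by
        simpa using congrFun h 1
      have hP := plucker_ne_zero_symm hω.1
      rcases hω.2 hrel with (h5 | h6) | h7
      · exact h5
      · refine absurd ?_ (disc_of_mem_formOrbit₆ h6 hP)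
        have h4 := disc_eq_hess (plucker ω 3) (plucker ω 1)
        rw [h2, h3] at h4
        linear_combination h4 / 3
      · exact absurd h2 (((hess_of_mem_formOrbit₇ h7).2 hP).1 hdet)

/-- The pencil of `XZ` and `Y² - XY + y Z²` has the cubic `-μ(λ² + y μ²)/4`. The parameter `y`
splits the double root, and the discriminant on rows 4 and 1 is `-y/4096`. The orbit of `form₅`
stays away because a Hessian coefficient is nonzero nearby. -/
theorem isComplexSubmanifold_formOrbit₇ : IsComplexSubmanifold (formOrbit form₇) 8 := by
  refine isComplexSubmanifold_formOrbit (n := 1) (α := 4) (β := 1) (c := 1 / 2)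
    (u := fun _ => ![0, 0, 0, 0, 1 / 2, 0]) (v := fun y => ![0, 1, y 0, -1 / 2, 0, 0])
    (h := fun x y => ![-4096 * disc x y])
    (Or.inr (MulAction.mem_orbit_self _)) (by decide) (by norm_num) ?_ ?_ ?_ ?_ ?_ ?_ ?_ rfl
  · exact differentiable_const _
  · refine differentiable_pi.mpr fun α => ?_
    fin_cases α <;> simp <;> fun_prop
  · intro y
    simp
  · rw [form₇_eq]
    congr 1 <;> funext α <;> fin_cases α <;> simp [prodLin]
  · refine contDiff_pi.mpr fun i => ?_
    fin_cases i
    exact contDiff_const.mul contDiff_disc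
  · intro y
    funext i
    fin_cases i
    simp [disc, quadDet, quadDetMixed]
    ring
  · have h1 : ∀ᶠ ω in nhds form₇, hess (plucker ω 1) (plucker ω 4) ≠ 0 := by
      refine (continuous_rows contDiff_hess_swap 4 1).continuousAt.eventually_ne ?_
      rw [rows_form₇.1, rows_form₇.2]
      simp [hess, quadDet, quadDetMixed]
    filter_upwards [eventually_near_form₇, h1] with ω hω hhess hrel
    constructor
    · intro h
      simp [(hess_of_mem_formOrbit₇ h (α := 4) (β := 1)).1]
    · intro h
      have h2 : disc (plucker ω 4) (plucker ω 1) = 0 := by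
        simpa using congrFun h 0
      rcases hω.2 hrel with (h5 | h6) | h7
      · exact absurd (hess_of_mem_formOrbit₅ h5 1 4).1 hhess
      · exact absurd h2 (disc_of_mem_formOrbit₆ h6 hω.1)
      · exact h7

/-- A nonzero discriminant is an open condition, so this orbit is open among the pencils and needs
no equation beyond the Plücker relations. -/
theorem isComplexSubmanifold_formOrbit₆ : IsComplexSubmanifold (formOrbit form₆) 9 := by
  refine isComplexSubmanifold_formOrbit (n := 0) (α := 4) (β := 5) (c := 1 / 4)
    (u := fun _ => ![0, 0, 0, 1 / 2, 1 / 2, 0]) (v := fun _ => ![0, 0, 0, 1 / 2, 0, 1 / 2])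
    (h := fun _ _ => 0)
    (Or.inl (Or.inr (MulAction.mem_orbit_self _))) (by decide) (by norm_num) ?_ ?_ ?_ ?_ ?_ ?_ ?_ rfl
  · exact differentiable_const _
  · exact differentiable_const _
  · intro y
    simp
    norm_num
  · rw [form₆_eq]
    congr 1 <;> funext α <;> fin_cases α <;> simp [prodLin]
  · exact contDiff_const
  · intro y
    exact Subsingleton.elim _ _
  · have h1 : ∀ᶠ ω in nhds form₆, disc (plucker ω 4) (plucker ω 5) ≠ 0 := by
      refine (continuous_rows contDiff_disc 4 5).continuousAt.eventually_ne ?_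
      rw [rows_form₆.1, rows_form₆.2]
      simp [disc, quadDet, quadDetMixed]
    filter_upwards [eventually_near_form₆, h1] with ω hω hdisc hrel
    refine ⟨fun _ => rfl, fun _ => ?_⟩
    rcases hω.2 hrel with (h5 | h6) | h7
    · exact absurd (disc_of_mem_formOrbit₅ h5 4 5) hdisc
    · exact h6
    · exact absurd (hess_of_mem_formOrbit₇ h7).1 hdisc

/-! ### Closures of the orbits -/

theorem isClosed_decomposable : IsClosed {ω : FormSpace 2 | Decomposable ω} := by
  simp only [Decomposable, Set.ofPred_forall]
  refine isClosed_iInter fun α => isClosed_iInter fun β => isClosed_iInter fun γ =>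
    isClosed_iInter fun δ => isClosed_eq ?_ ?_
  · exact (continuous_plucker _ _).mul (continuous_plucker _ _)
  · exact ((continuous_plucker _ _).mul (continuous_plucker _ _)).sub
      ((continuous_plucker _ _).mul (continuous_plucker _ _))

theorem isClosed_rows_eq_zero {f : (Fin 6 → ℂ) × (Fin 6 → ℂ) → ℂ} (hf : ContDiff ℂ 1 f) :
    IsClosed {ω : FormSpace 2 | ∀ α β, f (plucker ω α, plucker ω β) = 0} := by
  simp only [Set.ofPred_forall]
  exact isClosed_iInter fun α => isClosed_iInter fun β =>
    isClosed_eq (continuous_rows hf α β) continuous_const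

theorem mem_pencilOrbits_rep_iff (F : Foliation 2) :
    F.1.rep ∈ pencilOrbits ↔ F ∈ orbit F₅ ∨ F ∈ orbit F₆ ∨ F ∈ orbit F₇ := by
  rw [F₅, F₆, F₇, mem_orbit_ofForm_iff, mem_orbit_ofForm_iff, mem_orbit_ofForm_iff, ← or_assoc]
  rfl

theorem decomposable_smul_iff (c : ℂˣ) (ω : FormSpace 2) :
    Decomposable (c • ω) ↔ Decomposable ω := by
  have key : ∀ (c : ℂˣ) (ω : FormSpace 2), Decomposable ω → Decomposable (c • ω) := by
    intro c ω h α β γ δ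
    simp only [Units.smul_def, map_smul, Pi.smul_apply, smul_eq_mul]
    linear_combination (c : ℂ) ^ 2 * h α β γ δ
  exact ⟨fun h => by simpa using key c⁻¹ _ h, key c ω⟩

theorem isClosed_setOf_rep_mem_pencilOrbits :
    IsClosed {F : Foliation 2 | F.1.rep ∈ pencilOrbits} := by
  have h : {F : Foliation 2 | F.1.rep ∈ pencilOrbits} =
      {F : Foliation 2 | F.1.rep ∈ {ω | Decomposable ω}} := by
    ext F
    exact mem_pencilOrbits_iff F.2
  rw [h]
  exact isClosed_setOf_rep_mem isClosed_decomposable decomposable_smul_iff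

theorem isClosed_setOf_rep_rows {f : (Fin 6 → ℂ) × (Fin 6 → ℂ) → ℂ} (hf : ContDiff ℂ 1 f) {n : ℕ}
    (hs : ∀ (c : ℂ) x, f (c • x) = c ^ n * f x) :
    IsClosed {F : Foliation 2 | ∀ α β, f (plucker F.1.rep α, plucker F.1.rep β) = 0} := by
  refine isClosed_setOf_rep_mem (isClosed_rows_eq_zero hf) fun c ω => ?_
  refine forall_congr' fun α => forall_congr' fun β => ?_
  have h1 : f (plucker (c • ω) α, plucker (c • ω) β) =
      (c : ℂ) ^ n * f (plucker ω α, plucker ω β) := by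
    rw [Units.smul_def, map_smul, ← hs]
    rfl
  rw [h1, mul_eq_zero, or_iff_right (pow_ne_zero n c.ne_zero)]

theorem quadDet_smul (c : ℂ) (x : Fin 6 → ℂ) : quadDet (c • x) = c ^ 3 * quadDet x := by
  simp only [quadDet, Pi.smul_apply, smul_eq_mul]
  ring

theorem quadDetMixed_smul (c : ℂ) (x y : Fin 6 → ℂ) :
    quadDetMixed (c • x) (c • y) = c ^ 3 * quadDetMixed x y := by
  simp only [quadDetMixed, Pi.smul_apply, smul_eq_mul]
  ring

theorem disc_smul (c : ℂ) (x y : Fin 6 → ℂ) : disc (c • x) (c • y) = c ^ 12 * disc x y := by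
  simp only [disc, quadDet_smul, quadDetMixed_smul]
  ring

theorem hess_smul (c : ℂ) (x y : Fin 6 → ℂ) : hess (c • x) (c • y) = c ^ 6 * hess x y := by
  simp only [hess, quadDet_smul, quadDetMixed_smul]
  ring

theorem mem_orbit₇_or_mem_orbit₅ {F : Foliation 2} (h : F.1.rep ∈ pencilOrbits)
    (hd : ∀ α β, disc (plucker F.1.rep α) (plucker F.1.rep β) = 0) :
    F ∈ orbit F₅ ∨ F ∈ orbit F₇ := by
  obtain ⟨α, β, hP⟩ := exists_plucker_ne_zero F.1.rep_nonzero
  rcases (mem_pencilOrbits_rep_iff F).mp h with h5 | h6 | h7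
  · exact Or.inl h5
  · rw [F₆, mem_orbit_ofForm_iff] at h6
    exact absurd (hd α β) (disc_of_mem_formOrbit₆ h6 hP)
  · exact Or.inr h7

theorem mem_orbit₅ {F : Foliation 2} (h : F.1.rep ∈ pencilOrbits)
    (hd : ∀ α β, disc (plucker F.1.rep α) (plucker F.1.rep β) = 0)
    (hh : ∀ α β, hess (plucker F.1.rep β) (plucker F.1.rep α) = 0) : F ∈ orbit F₅ := by
  obtain ⟨α, β, hP⟩ := exists_plucker_ne_zero F.1.rep_nonzero
  rcases mem_orbit₇_or_mem_orbit₅ h hd with h5 | h7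
  · exact h5
  · rw [F₇, mem_orbit_ofForm_iff] at h7
    rcases ((hess_of_mem_formOrbit₇ h7).2 hP).2 with h1 | h1
    · exact absurd (hh β α) h1
    · exact absurd (hh α β) h1

theorem closure_orbit₅_subset : closure (orbit F₅) ⊆ orbit F₅ := by
  have h1 := isClosed_setOf_rep_mem_pencilOrbits
  have h2 := isClosed_setOf_rep_rows contDiff_disc (fun c x => disc_smul c x.1 x.2)
  have h3 := isClosed_setOf_rep_rows contDiff_hess_swap (fun c x => hess_smul c x.2 x.1)
  refine (closure_minimal ?_ ((h1.inter h2).inter h3)).trans fun F hF => ?_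
  · intro F hF
    refine ⟨⟨(mem_pencilOrbits_rep_iff F).mpr (Or.inl hF), ?_⟩, ?_⟩ <;>
      rw [F₅, mem_orbit_ofForm_iff] at hF
    · exact disc_of_mem_formOrbit₅ hF
    · exact fun α β => (hess_of_mem_formOrbit₅ hF β α).1
  · exact mem_orbit₅ hF.1.1 hF.1.2 hF.2

theorem closure_orbit₇_subset : closure (orbit F₇) ⊆ orbit F₅ ∪ orbit F₇ := by
  have h1 := isClosed_setOf_rep_mem_pencilOrbits
  have h2 := isClosed_setOf_rep_rows contDiff_disc (fun c x => disc_smul c x.1 x.2)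
  refine (closure_minimal ?_ (h1.inter h2)).trans fun F hF => ?_
  · intro F hF
    refine ⟨(mem_pencilOrbits_rep_iff F).mpr (Or.inr (Or.inr hF)), ?_⟩
    rw [F₇, mem_orbit_ofForm_iff] at hF
    exact fun α β => (hess_of_mem_formOrbit₇ hF).1
  · exact mem_orbit₇_or_mem_orbit₅ hF.1 hF.2

theorem closure_orbit₆_subset : closure (orbit F₆) ⊆ orbit F₅ ∪ orbit F₆ ∪ orbit F₇ := by
  refine (closure_minimal ?_ isClosed_setOf_rep_mem_pencilOrbits).trans fun F hF => ?_
  · exact fun F hF => (mem_pencilOrbits_rep_iff F).mpr (Or.inr (Or.inl hF))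
  · rw [Set.union_assoc]
    exact (mem_pencilOrbits_rep_iff F).mp hF

/-- If the form of the model `ω` is a limit of a curve in the orbit of `η`, then the orbit of the
foliation of `ω` lies in the closure of the orbit of the foliation of `η`. -/
theorem orbit_subset_closure {ω η : FormSpace 2} (hω : NoCommonFactor ω.1)
    (hη : NoCommonFactor η.1) {f : ℂ → FormSpace 2} (hf : ContinuousAt f 0) (hf0 : f 0 = ω)
    (h : ∀ᶠ t in nhdsWithin (0 : ℂ) {0}ᶜ, f t ∈ formOrbit η) :
    orbit (Foliation.ofForm ω hω) ⊆ closure (orbit (Foliation.ofForm η hη)) := by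
  intro F hF
  rw [mem_orbit_ofForm_iff] at hF
  obtain ⟨φ, hφ, hφF⟩ := exists_of_mem_formOrbit hF
  have hc : Continuous (pullback φ : FormSpace 2 →ₗ[ℂ] FormSpace 2) :=
    (pullback φ).continuous_of_finiteDimensional
  refine mem_closure_of_tendsto_form (f := fun t => pullback φ (f t))
    (hc.continuousAt.comp hf) (by rw [hφF, hf0]) ?_
  filter_upwards [h] with t ht
  rw [cone_orbit_ofForm]
  exact mem_formOrbit_trans (pullback_mem_formOrbit hφ _) ht

/-- The unfolding used for the chart at `form₇` has nonzero discriminant for `t ≠ 0`, so it lies in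
the orbit of `form₆` for small `t ≠ 0`. -/
theorem orbit₇_subset_closure : orbit F₇ ⊆ closure (orbit F₆) := by
  let v : ℂ → Fin 6 → ℂ := fun t => ![0, 1, t, -1 / 2, 0, 0]
  have hv : Differentiable ℂ v := by
    refine differentiable_pi.mpr fun α => ?_
    fin_cases α <;> simp [v]
  have hc := (differentiable_pform (differentiable_const (![0, 0, 0, 0, 1 / 2, 0] : Fin 6 → ℂ))
    hv).continuous.continuousAt (x := 0)
  have h0 : pform ![0, 0, 0, 0, 1 / 2, 0] (v 0) = form₇ := by
    rw [form₇_eq]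
    congr 1 <;> funext α <;> fin_cases α <;> simp [prodLin, v]
  refine orbit_subset_closure noCommonFactor₇ noCommonFactor₆ hc h0 ?_
  have h1 := hc.eventually (h0.symm ▸ eventually_near_form₇)
  filter_upwards [h1.filter_mono nhdsWithin_le_nhds, self_mem_nhdsWithin] with t ht ht0
  have hd : disc (plucker (pform ![0, 0, 0, 0, 1 / 2, 0] (v t)) 4)
      (plucker (pform ![0, 0, 0, 0, 1 / 2, 0] (v t)) 1) = -t / 4096 := by
    simp [plucker_row, v, disc, quadDet, quadDetMixed]
    ring
  have hne : -t / 4096 ≠ 0 := div_ne_zero (neg_ne_zero.mpr ht0) (by norm_num)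
  rcases ht.2 (decomposable_pform _ _ 4 1) with (h5 | h6) | h7
  · exact absurd (hd.symm.trans (disc_of_mem_formOrbit₅ h5 4 1)) hne
  · exact h6
  · exact absurd (hd.symm.trans (hess_of_mem_formOrbit₇ h7).1) hne

theorem orbit₅_subset_closure : orbit F₅ ⊆ closure (orbit F₇) := by
  -- In the unfolding of `form₅`, take `y₀ = -6t²` and `y₁ = 16t³`. The cubic becomes `-(λ - 2tμ)²(λ
  -- + 4tμ)/4`, with a double root that is not triple for `t ≠ 0`.
  let v : ℂ → Fin 6 → ℂ := fun t => ![0, 0, 16 * t ^ 3, 1 / 2, 0, -6 * t ^ 2]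
  have hv : Differentiable ℂ v := by
    refine differentiable_pi.mpr fun α => ?_
    fin_cases α <;> simp [v]
  have hc := (differentiable_pform (differentiable_const (![0, 1, 0, 0, -1 / 2, 0] : Fin 6 → ℂ))
    hv).continuous.continuousAt (x := 0)
  have h0 : pform ![0, 1, 0, 0, -1 / 2, 0] (v 0) = form₅ := by
    rw [form₅_eq]
    congr 1 <;> funext α <;> fin_cases α <;> simp [prodLin, v]
    norm_num
  refine orbit_subset_closure noCommonFactor₅ noCommonFactor₇ hc h0 ?_
  have h1 := hc.eventually (h0.symm ▸ eventually_near_form₅)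
  filter_upwards [h1.filter_mono nhdsWithin_le_nhds, self_mem_nhdsWithin] with t ht ht0
  have hd : disc (plucker (pform ![0, 1, 0, 0, -1 / 2, 0] (v t)) 3)
      (plucker (pform ![0, 1, 0, 0, -1 / 2, 0] (v t)) 1) = 0 := by
    simp [plucker_row, v, disc, quadDet, quadDetMixed]
    ring
  have hh : hess (plucker (pform ![0, 1, 0, 0, -1 / 2, 0] (v t)) 3)
      (plucker (pform ![0, 1, 0, 0, -1 / 2, 0] (v t)) 1) = 9 / 64 * t ^ 2 := by
    simp [plucker_row, v, hess, quadDet, quadDetMixed]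
    ring
  have hne : 9 / 64 * t ^ 2 ≠ 0 := mul_ne_zero (by norm_num) (pow_ne_zero 2 ht0)
  rcases ht.2 (decomposable_pform _ _ 1 3) with (h5 | h6) | h7
  · exact absurd (hh.symm.trans (hess_of_mem_formOrbit₅ h5 3 1).1) hne
  · exact absurd hd (disc_of_mem_formOrbit₆ h6 (plucker_ne_zero_symm ht.1))
  · exact h7

end PlaneFoliation

/-! ### Proof of the proposition -/

theorem mainTheorem12 :
    (∀ F : PlaneFoliation.Foliation 2, PlaneFoliation.IsPencilOfConics F →
      F ∈ PlaneFoliation.orbit PlaneFoliation.F₅ ∨ F ∈ PlaneFoliation.orbit PlaneFoliation.F₆ ∨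
        F ∈ PlaneFoliation.orbit PlaneFoliation.F₇) ∧
    (closure (PlaneFoliation.orbit PlaneFoliation.F₅) = PlaneFoliation.orbit PlaneFoliation.F₅ ∧
      PlaneFoliation.HasDimension (PlaneFoliation.orbit PlaneFoliation.F₅) 6) ∧
    (closure (PlaneFoliation.orbit PlaneFoliation.F₇) =
        PlaneFoliation.orbit PlaneFoliation.F₅ ∪ PlaneFoliation.orbit PlaneFoliation.F₇ ∧
      PlaneFoliation.HasDimension (PlaneFoliation.orbit PlaneFoliation.F₇) 7) ∧
    (closure (PlaneFoliation.orbit PlaneFoliation.F₆) =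
        PlaneFoliation.orbit PlaneFoliation.F₅ ∪ PlaneFoliation.orbit PlaneFoliation.F₆ ∪
          PlaneFoliation.orbit PlaneFoliation.F₇ ∧
      PlaneFoliation.HasDimension (PlaneFoliation.orbit PlaneFoliation.F₆) 8) := by
  open PlaneFoliation in
  refine ⟨fun F hF => ?_, ⟨?_, ?_⟩, ⟨?_, ?_⟩, ?_, ?_⟩
  · obtain ⟨u, v, huv⟩ := hF.exists_rep_eq
    rw [← mem_pencilOrbits_rep_iff, huv]
    exact Nondegenerate.mem_pencilOrbits (huv ▸ F.2.nondegenerate)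
  · exact closure_orbit₅_subset.antisymm subset_closure
  · rw [HasDimension, F₅, cone_orbit_ofForm]
    exact isComplexSubmanifold_formOrbit₅
  · exact closure_orbit₇_subset.antisymm (Set.union_subset orbit₅_subset_closure subset_closure)
  · rw [HasDimension, F₇, cone_orbit_ofForm]
    exact isComplexSubmanifold_formOrbit₇
  -- The orbit of `F₅` is reached through the closure of the orbit of `F₇`.
  · exact closure_orbit₆_subset.antisymm (Set.union_subset (Set.union_subset
      (orbit₅_subset_closure.trans (closure_minimal orbit₇_subset_closure isClosed_closure))
      subset_closure) orbit₇_subset_closure)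
  · rw [HasDimension, F₆, cone_orbit_ofForm]
    exact isComplexSubmanifold_formOrbit₆
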